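/- Let $K$ be a non-archimedean local field of characteristic $p>0$ with valuation ring $R$, maximal ideal $\mathfrak m$ and (finite) residue field $k$, and let $\bar K$ be an algebraic closure of $K$. Regard $R$ as a $k$-algebra through the unique ring homomorphism $k\to R$ that splits the reduction map $R\to k$. For a finite extension $K'\subset\bar K$ of $K$ let $R'$ be its valuation ring, i.e. the integral closure of $R$ in $K'$, with its $\mathfrak m R'$-adic topology. For $i\ge 0$ let $R^{p^i}\subset R$ be the subring of $p^i$-th powers of elements of $R$. Let $n\ge 0$ and let $\mathscr G$ be a formal group scheme over $k$ whose underlying formal scheme is $\mathrm{Spf}\,k[[x_1,\dots,x_n]]$, with group law written additively. (Commutativity is not needed; if $\mathscr G$ is not commutative, $+g$ denotes translation by $g$ from the right.) Closed formal subschemes of $\mathscr G_{\mathrm{Spf}(R')}$ correspond to ideals of $R'[[x_1,\dots,x_n]]$, and base change corresponds to extension of ideals. The group $\mathscr G(R')$ is the set of $n$-tuples of elements of the maximal ideal of $R'$. For $g\in\mathscr G(R')$ and a closed formal subscheme $\mathscr Y\subset\mathscr G_{\mathrm{Spf}(R')}$, the translate $\mathscr Y+g$ is the closed formal subscheme on which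 $f$ vanishes if and only if $f(x+g)$ vanishes on $\mathscr Y$. For $A=k$ or $A=R^{p^i}$, a closed formal subscheme of $\mathscr G_{\mathrm{Spf}(R')}$ is said to be defined over $A$ if its ideal is generated by an ideal of $A[[x_1,\dots,x_n]]$, i.e. if it is the base change of a closed formal subscheme of $\mathscr G_{\mathrm{Spf}(A)}$. Let $\mathscr X\subset\mathscr G_{\mathrm{Spf}(R)}$ be a closed formal subscheme. Suppose that for each $i\ge 0$ there exist a finite field extension $K'\subset\bar K$ of $K$, with valuation ring $R'$, and $g\in\mathscr G(R')$ such that $\mathscr X_{\mathrm{Spf}(R')}+g$ is defined over $R^{p^i}$. Then there exist a finite field extension $K'\subset\bar K$ of $K$, with valuation ring $R'$, and $g\in\mathscr G(R')$ such that $\mathscr X_{\mathrm{Spf}(R')}+g$ is defined over $k$. -/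

import Mathlib

open scoped ValuativeRel

/-- An `n`-dimensional formal group over `k`: a group object in formal schemes over `k` whose
underlying formal scheme is `Spf k⟦x₁, …, xₙ⟧`.  The comultiplication is given by the family
`mul` of power series in two sets of variables (`Sum.inl` for the first factor, `Sum.inr` for the
second), the coinverse by the family `inv`.  The unit is the zero section (the only `k`-valued
point when `k` is a field).  Commutativity is not required. -/
structure MvFormalGroup (n : ℕ) (k : Type*) [CommRing k] where
  mul : Fin n → MvPowerSeries (Fin n ⊕ Fin n) k
  inv : Fin n → MvPowerSeries (Fin n) k
  mul_constantCoeff : ∀ j, MvPowerSeries.constantCoeff (mul j) = 0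
  inv_constantCoeff : ∀ j, MvPowerSeries.constantCoeff (inv j) = 0
  mul_zero : ∀ j, (mul j).subst (Sum.elim MvPowerSeries.X 0) =
    (MvPowerSeries.X j : MvPowerSeries (Fin n) k)
  zero_mul : ∀ j, (mul j).subst (Sum.elim 0 MvPowerSeries.X) =
    (MvPowerSeries.X j : MvPowerSeries (Fin n) k)
  mul_inv : ∀ j, (mul j).subst (Sum.elim MvPowerSeries.X inv) =
    (0 : MvPowerSeries (Fin n) k)
  inv_mul : ∀ j, (mul j).subst (Sum.elim inv MvPowerSeries.X) =
    (0 : MvPowerSeries (Fin n) k)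
  mul_assoc : ∀ j,
    (mul j).subst (Sum.elim
      (fun i => (mul i).subst (Sum.elim
        (fun l => (MvPowerSeries.X (Sum.inl l) : MvPowerSeries (Fin n ⊕ Fin n ⊕ Fin n) k))
        (fun l => MvPowerSeries.X (Sum.inr (Sum.inl l)))))
      (fun l => MvPowerSeries.X (Sum.inr (Sum.inr l)))) =
    (mul j).subst (Sum.elim
      (fun l => MvPowerSeries.X (Sum.inl l))
      (fun i => (mul i).subst (Sum.elim
        (fun l => (MvPowerSeries.X (Sum.inr (Sum.inl l)) :
          MvPowerSeries (Fin n ⊕ Fin n ⊕ Fin n) k))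
        (fun l => MvPowerSeries.X (Sum.inr (Sum.inr l))))))

section AdicRing

open scoped MvPowerSeries.WithPiTopology

/-- For an `𝔞`-adic ring `A`, the evaluation `f(a)` of a power series `f` over `A` at a family
`a` of elements of `A⟦x₁, …, xₙ⟧`, where `A⟦x₁, …, xₙ⟧` carries the product of the `𝔞`-adic
topologies (which is the `(𝔞, x₁, …, xₙ)`-adic topology). -/
noncomputable def adicEval {A : Type*} [CommRing A] (𝔞 : Ideal A) {n : ℕ} {σ : Type*}
    (a : σ → MvPowerSeries (Fin n) A) (f : MvPowerSeries σ A) : MvPowerSeries (Fin n) A :=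
  letI : WithIdeal A := ⟨𝔞⟩
  MvPowerSeries.eval₂ (MvPowerSeries.C : A →+* MvPowerSeries (Fin n) A) a f

end AdicRing

/-- The set `𝒢(A)` of points of `𝒢 = Spf k⟦x₁, …, xₙ⟧` with values in an `𝔞`-adic ring `A`:
a continuous homomorphism `k⟦x₁, …, xₙ⟧ → A` is given by the images of the `xᵢ`, an arbitrary
family of topologically nilpotent elements, that is, of elements of the radical of `𝔞`. -/
abbrev AdicPoint (n : ℕ) {A : Type*} [CommRing A] (𝔞 : Ideal A) : Type _ :=
  Fin n → 𝔞.radical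

/-- The homomorphism `f ↦ f(x + g)` of `A⟦x₁, …, xₙ⟧` which defines the translation
`x ↦ x + g` of `𝒢_{Spf A}`.  Here `φ : k → A` is the structure map of the `𝔞`-adic ring `A`. -/
noncomputable def MvFormalGroup.translation {n : ℕ} {k : Type*} [CommRing k]
    (G : MvFormalGroup n k) {A : Type*} [CommRing A] (𝔞 : Ideal A) (φ : k →+* A)
    (g : AdicPoint n 𝔞) (f : MvPowerSeries (Fin n) A) : MvPowerSeries (Fin n) A :=
  adicEval 𝔞
    (fun j => adicEval 𝔞
      (Sum.elim MvPowerSeries.X (fun i => MvPowerSeries.C (g i : A)))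
      ((G.mul j).map φ)) f

/-- If `𝒳 ⊆ 𝒢_{Spf A}` is the closed formal subscheme defined by the ideal `I`, this is the ideal
defining the translate `𝒳 + g`: a function `f` vanishes on `𝒳 + g` if and only if `f(x + g)`
vanishes on `𝒳`.  (As `f ↦ f(x + g)` is a ring homomorphism for complete `A`, these `f` already
form an ideal.) -/
noncomputable def MvFormalGroup.translate {n : ℕ} {k : Type*} [CommRing k]
    (G : MvFormalGroup n k) {A : Type*} [CommRing A] (𝔞 : Ideal A) (φ : k →+* A)
    (g : AdicPoint n 𝔞) (I : Ideal (MvPowerSeries (Fin n) A)) :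
    Ideal (MvPowerSeries (Fin n) A) :=
  Ideal.span {f | G.translation 𝔞 φ g f ∈ I}

/-- The ideal of `B⟦x₁, …, xₙ⟧` defining the base change along `φ : A → B` of the closed formal
subscheme of `Spf A⟦x₁, …, xₙ⟧` defined by `I`. -/
noncomputable def formalBaseChange {n : ℕ} {A B : Type*} [CommRing A] [CommRing B] (φ : A →+* B)
    (I : Ideal (MvPowerSeries (Fin n) A)) : Ideal (MvPowerSeries (Fin n) B) :=
  I.map (MvPowerSeries.map φ)

/-- The closed formal subscheme of `Spf B⟦x₁, …, xₙ⟧` defined by `I` is defined over `A`: it is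
the base change along `φ : A → B` of a closed formal subscheme of `Spf A⟦x₁, …, xₙ⟧`. -/
def FormallyDefinedOver {n : ℕ} {A B : Type*} [CommRing A] [CommRing B] (φ : A →+* B)
    (I : Ideal (MvPowerSeries (Fin n) B)) : Prop :=
  ∃ J : Ideal (MvPowerSeries (Fin n) A), formalBaseChange φ J = I

section LocalField

variable (K : Type*) [Field K] [ValuativeRel K]

/-- The valuation ring `R'` of an algebraic extension `L` of the local field `K`: the
integral closure of `R = 𝒪[K]` in `L`. -/
abbrev ExtInteger (L : Type*) [Field L] [Algebra K L] : Type _ :=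
  integralClosure 𝒪[K] L

/-- The ideal `𝔪R'` of `R'`, where `𝔪` is the maximal ideal of `R = 𝒪[K]`; the valuation
topology of `R'` is the `𝔪R'`-adic one. -/
noncomputable abbrev extIdeal (L : Type*) [Field L] [Algebra K L] : Ideal (ExtInteger K L) :=
  𝓂[K].map (algebraMap 𝒪[K] (ExtInteger K L))

/-- The residue field `k` of a local field of positive characteristic embeds in a unique way
as a coefficient field in the valuation ring. -/
theorem existsUnique_coefficientField [TopologicalSpace K] [IsNonarchimedeanLocalField K]
    (p : ℕ) [Fact p.Prime] [CharP K p] :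
    ∃! s : 𝓀[K] →+* 𝒪[K], ∀ a, IsLocalRing.residue 𝒪[K] (s a) = a := by
  classical
  let := IsTopologicalAddGroup.rightUniformSpace K
  have := isUniformAddGroup_of_addCommGroup (G := K)
  let q := Nat.card 𝓀[K]
  have hk : ∀ a : 𝓀[K], a ^ q = a := fun a => by
    have := Fintype.ofFinite 𝓀[K]
    simpa [q, Nat.card_eq_fintype_card] using FiniteField.pow_card a
  have : CharP 𝓀[K] p := by
    refine (CharP.charP_iff_prime_eq_zero (Fact.out : p.Prime)).2 ?_
    rw [← map_natCast (IsLocalRing.residue 𝒪[K]), CharP.cast_eq_zero, map_zero]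
  obtain ⟨d, hd⟩ : ∃ d : ℕ+, q = p ^ (d : ℕ) := by
    have := Fintype.ofFinite 𝓀[K]
    obtain ⟨d, -, h⟩ := FiniteField.card 𝓀[K] p
    exact ⟨d, by simpa [q, Nat.card_eq_fintype_card] using h⟩
  have hq1 : 1 < q := hd ▸ Nat.one_lt_pow d.ne_zero (Fact.out : p.Prime).one_lt
  have hq0 : (q : 𝒪[K]) = 0 := by
    rw [hd, Nat.cast_pow, CharP.cast_eq_zero, zero_pow d.ne_zero]
  -- the roots of `X ^ q - X` in `R` map bijectively to `k`
  have inj : ∀ x y : 𝒪[K], x ^ q = x → y ^ q = y →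
      IsLocalRing.residue 𝒪[K] x = IsLocalRing.residue 𝒪[K] y → x = y := by
    intro x y hx hy hxy
    have hz : (x - y) ^ q = x - y := by rw [hd, sub_pow_char_pow, ← hd, hx, hy]
    have hm : x - y ∈ 𝓂[K] := by
      rw [← IsLocalRing.residue_eq_zero_iff, map_sub, hxy, sub_self]
    by_contra hne
    have h1 : (x - y) ^ (q - 1) = 1 := by
      refine mul_left_cancel₀ (sub_ne_zero.2 hne) ?_
      rw [mul_one, ← pow_succ', Nat.sub_add_cancel hq1.le, hz]
    exact (IsLocalRing.maximalIdeal.isMaximal 𝒪[K]).ne_top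
      ((Ideal.eq_top_iff_one _).2 (h1 ▸ Ideal.pow_mem_of_mem _ hm _ (Nat.sub_pos_of_lt hq1)))
  have lift : ∀ a : 𝓀[K], ∃ x : 𝒪[K], x ^ q = x ∧ IsLocalRing.residue 𝒪[K] x = a := by
    intro a
    obtain ⟨a₀, rfl⟩ := IsLocalRing.residue_surjective a
    obtain ⟨x, hx, hxa⟩ := HenselianRing.is_henselian (I := 𝓂[K])
      (Polynomial.X ^ q - Polynomial.X : Polynomial 𝒪[K])
      (Polynomial.monic_X_pow_sub (by simpa using hq1)) a₀
      (by
        rw [← IsLocalRing.residue_eq_zero_iff]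
        simp [hk])
      (by simp [Polynomial.derivative_X_pow, hq0])
    refine ⟨x, by simpa [sub_eq_zero] using hx, ?_⟩
    rw [← IsLocalRing.residue_eq_zero_iff, map_sub, sub_eq_zero] at hxa
    exact hxa
  choose t ht htr using lift
  refine ⟨{ toFun := t, map_one' := ?_, map_mul' := ?_, map_zero' := ?_, map_add' := ?_ },
    htr, ?_⟩
  · exact inj _ _ (ht _) (one_pow _) (by rw [htr, map_one])
  · exact fun a b => inj _ _ (ht _) (by rw [mul_pow, ht, ht]) (by simp [htr])
  · exact inj _ _ (ht _) (zero_pow (by omega)) (by rw [htr, map_zero])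
  · exact fun a b => inj _ _ (ht _) (by rw [hd, add_pow_char_pow, ← hd, ht, ht]) (by simp [htr])
  · intro s hs
    ext1 a
    exact inj _ _ (by rw [← map_pow, hk]) (ht a) (by rw [hs]; exact (htr a).symm)

/-- The embedding `k → R` through which `R` is a `k`-algebra: the unique ring homomorphism which
splits the reduction map `R → k`. -/
noncomputable def coefficientField [TopologicalSpace K] [IsNonarchimedeanLocalField K]
    (p : ℕ) [Fact p.Prime] [CharP K p] : 𝓀[K] →+* 𝒪[K] :=
  (existsUnique_coefficientField K p).choose

theorem residue_coefficientField [TopologicalSpace K] [IsNonarchimedeanLocalField K]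
    (p : ℕ) [Fact p.Prime] [CharP K p] (a : 𝓀[K]) :
    IsLocalRing.residue 𝒪[K] (coefficientField K p a) = a :=
  (existsUnique_coefficientField K p).choose_spec.1 a

end LocalField

/-! Let t be a uniformizer of R and I₀ ⊂ k⟦x⟧ the reduction of the ideal I of 𝒳. A p^N-th power in R
is constant modulo t^N, and translation by a topologically nilpotent point does not change the
special fibre. Hence for every N some translate of 𝒳 agrees modulo t^N with the constant subscheme
given by I₀ (`comap_le_and_le_of_formallyDefinedOver`). What remains is an approximation statement:
a problem solvable modulo every t^N, over varying finite extensions, has an exact solution over one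
of them.

Division with remainder turns the problem into equations. Call a monomial standard if its exponent
is not a leading exponent of I₀. Every series has a remainder supported on standard monomials modulo
I₀ and, by t-adic completeness, also modulo I; the approximate solutions force the remainder modulo
I to be unique. For f ∈ I₀ the remainder of f(x + y) modulo I has coefficients in R⟦y⟧. Let 𝔟 be the
ideal generated by all these coefficients. Approximate solutions kill 𝔟 modulo t^N, so no power of t
lies in 𝔟, and `exists_point_of_pow_notMem` gives an exact zero g of 𝔟 over a finite extension.

At this g the extension of I₀ lies in the ideal of the translate. Equality is a contraction argument
(`eq_zero_of_isNearIdentity`): let c be in the ideal of the translate and supported on standard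
monomials. Translation changes c only by multiples of the coordinates of g, and the translated
series has remainder 0, so c lies in every power of the ideal of these coordinates and vanishes. -/

namespace MvPowerSeries

/-! ### Homomorphisms between power series rings. -/

theorem coeff_eq_zero_of_mem_span_X_pow {σ R : Type*} [CommRing R] {N : ℕ}
    {f : MvPowerSeries σ R} (hf : f ∈ Ideal.span (Set.range (X : σ → MvPowerSeries σ R)) ^ N)
    {d : σ →₀ ℕ} (hd : d.degree < N) : coeff d f = 0 := by
  suffices h : (N : ℕ∞) ≤ f.order from
    coeff_of_lt_order (lt_of_lt_of_le (by exact_mod_cast hd) h)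
  clear hd
  induction N generalizing f with
  | zero => simp
  | succ N ih =>
    rw [pow_succ] at hf
    refine Submodule.mul_induction_on hf (fun a ha b hb => ?_) (fun a b ha hb => ?_)
    · have hb' : (1 : ℕ∞) ≤ b.order := by
        rw [one_le_order_iff_constCoeff_eq_zero]
        have : Ideal.span (Set.range (X : σ → MvPowerSeries σ R)) ≤
            RingHom.ker (constantCoeff (σ := σ) (R := R)) := by
          rw [Ideal.span_le]
          rintro _ ⟨i, rfl⟩
          simp
        exact this hb
      push_cast
      exact (add_le_add (ih ha) hb').trans le_order_mul
    · exact (le_min ha hb).trans min_order_le_add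

/-- Adic completeness for J = (X) gives a limit L of the truncations with every error in J ^ m.
Comparing the coefficient at d for m = deg d + 1 identifies L with f. -/
theorem sub_truncTotal_mem {σ R : Type*} [Finite σ] [CommRing R] (f : MvPowerSeries σ R) (N : ℕ) :
    f - (truncTotal N f : MvPolynomial σ R) ∈
      Ideal.span (Set.range (X : σ → MvPowerSeries σ R)) ^ N := by
  set J := Ideal.span (Set.range (X : σ → MvPowerSeries σ R)) with hJ
  have hmap : (MvPolynomial.idealOfVars σ R).map
      (MvPolynomial.coeToMvPowerSeries.ringHom (σ := σ) (R := R)) = J := by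
    rw [MvPolynomial.idealOfVars, Ideal.map_span, ← Set.range_comp, hJ]
    congr 2
    ext1 i
    simp
  obtain ⟨L, hL⟩ := IsPrecomplete.prec' (I := J) (M := MvPowerSeries σ R)
    (fun m => (truncTotal m f : MvPolynomial σ R)) (by
      intro m m' h
      rw [smul_eq_mul, Ideal.mul_top, SModEq.sub_mem, ← hmap, ← Ideal.map_pow]
      have := Ideal.mem_map_of_mem (MvPolynomial.coeToMvPowerSeries.ringHom (σ := σ) (R := R))
        (truncTotal_sub_truncTotal_mem_pow_idealOfVars (p := f) (le_refl m) h)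
      rw [map_sub] at this
      simpa using this)
  have hL' : ∀ m, ((truncTotal m f : MvPolynomial σ R) : MvPowerSeries σ R) - L ∈ J ^ m := by
    intro m
    have := hL m
    rwa [smul_eq_mul, Ideal.mul_top, SModEq.sub_mem] at this
  have : L = f := by
    ext d
    have h := coeff_eq_zero_of_mem_span_X_pow (hL' (d.degree + 1)) (d := d) (Nat.lt_succ_self _)
    rw [map_sub, sub_eq_zero, MvPolynomial.coeff_coe, coeff_truncTotal _ (Nat.lt_succ_self _)] at h
    exact h.symm
  subst this
  rw [← neg_sub]
  exact neg_mem (hL' N)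

/-- Ring homomorphisms out of a power series ring which send the variables to elements which are
topologically nilpotent for a separated adic topology are determined by their values on the
coefficients and the variables. -/
theorem ringHom_ext_of_isHausdorff {σ A T : Type*} [Finite σ] [CommRing A] [CommRing T]
    (J : Ideal T) [IsHausdorff J T] {u v : MvPowerSeries σ A →+* T}
    (hC : ∀ a, u (C a) = v (C a)) (hX : ∀ i, u (X i) = v (X i))
    (hJ : ∀ i, u (X i) ∈ J.radical) : u = v := by
  obtain ⟨M, hM⟩ : ∃ M, Ideal.span (Set.range fun i => u (X i)) ^ M ≤ J := by
    refine Ideal.exists_pow_le_of_le_radical_of_fg ?_ (Submodule.fg_span (Set.finite_range _))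
    rw [Ideal.span_le]
    rintro _ ⟨i, rfl⟩
    exact hJ i
  have hpoly : ∀ q : MvPolynomial σ A, u q = v q := by
    intro q
    have : u.comp (MvPolynomial.coeToMvPowerSeries.ringHom (σ := σ) (R := A)) =
        v.comp (MvPolynomial.coeToMvPowerSeries.ringHom (σ := σ) (R := A)) := by
      refine MvPolynomial.ringHom_ext (fun a => ?_) (fun i => ?_)
      · simpa using hC a
      · simpa using hX i
    simpa using RingHom.congr_fun this q
  -- The M-th power of the ideal of the images of the variables lies in J, so a tail of order M * N
  -- lands in J ^ N; `u` and `v` agree on the polynomial part.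
  have key : ∀ w : MvPowerSeries σ A →+* T, (∀ i, w (X i) = u (X i)) → ∀ N,
      ∀ f ∈ Ideal.span (Set.range (X : σ → MvPowerSeries σ A)) ^ (M * N), w f ∈ J ^ N := by
    intro w hw N f hf
    have h1 := Ideal.mem_map_of_mem w hf
    rw [Ideal.map_pow, Ideal.map_span, ← Set.range_comp, pow_mul] at h1
    have h2 : (w ∘ X : σ → T) = fun i => u (X i) := funext hw
    rw [h2] at h1
    exact Ideal.pow_right_mono hM N h1
  ext1 f
  rw [IsHausdorff.eq_iff_smodEq (I := J)]
  intro N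
  rw [smul_eq_mul, Ideal.mul_top, SModEq.sub_mem]
  have h1 := key u (fun _ => rfl) N _ (sub_truncTotal_mem f (M * N))
  have h2 := key v (fun i => (hX i).symm) N _ (sub_truncTotal_mem f (M * N))
  have := sub_mem h1 h2
  rwa [map_sub, map_sub, hpoly, sub_sub_sub_cancel_right] at this

theorem mem_span_range_X_of_constantCoeff_eq_zero {σ A : Type*} [Finite σ] [CommRing A]
    {f : MvPowerSeries σ A} (hf : constantCoeff f = 0) :
    f ∈ Ideal.span (Set.range (X : σ → MvPowerSeries σ A)) := by
  have h := sub_truncTotal_mem f 1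
  have h0 : truncTotal 1 f = 0 := by
    ext d
    by_cases hd : d.degree < 1
    · rw [coeff_truncTotal _ hd]
      have : d = 0 := by simpa [Finsupp.degree_eq_zero_iff] using hd
      simpa [this] using hf
    · rw [coeff_truncTotal_eq_zero _ (not_lt.1 hd)]
      simp
  simpa [h0] using h

/-- Modulo 𝔟 ^ l the constant terms of the images become nilpotent, so the images lie in the radical
of (X) and `ringHom_ext_of_isHausdorff` applies there. Separatedness of B then lets l grow. -/
theorem ringHom_ext_of_constantCoeff {σ τ A B : Type*} [Finite σ] [Finite τ] [CommRing A]
    [CommRing B] (𝔟 : Ideal B) [IsHausdorff 𝔟 B] {u v : MvPowerSeries σ A →+* MvPowerSeries τ B}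
    (hC : ∀ a, u (C a) = v (C a)) (hX : ∀ i, u (X i) = v (X i))
    (hJ : ∀ i, constantCoeff (u (X i)) ∈ 𝔟.radical) : u = v := by
  have key : ∀ l : ℕ, (map (Ideal.Quotient.mk (𝔟 ^ l))).comp u =
      (map (Ideal.Quotient.mk (𝔟 ^ l))).comp v := by
    intro l
    refine ringHom_ext_of_isHausdorff
      (Ideal.span (Set.range (X : τ → MvPowerSeries τ (B ⧸ 𝔟 ^ l))))
      (fun a => by simp [hC]) (fun i => by simp [hX]) (fun i => ?_)
    obtain ⟨m, hm⟩ := hJ i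
    refine ⟨m * l, mem_span_range_X_of_constantCoeff_eq_zero ?_⟩
    rw [map_pow, RingHom.comp_apply, constantCoeff_map, ← map_pow, Ideal.Quotient.eq_zero_iff_mem,
      pow_mul]
    exact Ideal.pow_mem_pow hm l
  ext f d
  rw [IsHausdorff.eq_iff_smodEq (I := 𝔟)]
  intro l
  rw [smul_eq_mul, Ideal.mul_top, SModEq.sub_mem, ← Ideal.Quotient.eq]
  have := congr_arg (coeff d) (RingHom.congr_fun (key l) f)
  simpa using this

-- A topologically nilpotent constant term makes a series topologically nilpotent, so evaluation is
-- a genuine continuous homomorphism. Afterwards only its values on constants and variables matter,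
-- and the topology can be forgotten.
open scoped WithPiTopology in
theorem exists_ringHom_eq_adicEval {σ A : Type*} [Finite σ] [CommRing A] (𝔞 : Ideal A)
    [IsAdicComplete 𝔞 A] {n : ℕ} (a : σ → MvPowerSeries (Fin n) A)
    (ha : ∀ i, constantCoeff (a i) ∈ 𝔞.radical) :
    ∃ e : MvPowerSeries σ A →+* MvPowerSeries (Fin n) A,
      (∀ r, e (C r) = C r) ∧ (∀ i, e (X i) = a i) ∧ ∀ f, adicEval 𝔞 a f = e f := by
  let : WithIdeal A := ⟨𝔞⟩
  obtain ⟨_, _⟩ := (IsAdic.isAdicComplete_iff (R := A) (I := 𝔞) rfl).1 inferInstance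
  have hE : HasEval a := by
    refine ⟨fun i => LinearTopology.isTopologicallyNilpotent_of_constantCoeff ?_, by simp⟩
    obtain ⟨m, hm⟩ := ha i
    suffices ∀ l : ℕ, ∃ n₀, ∀ n, n₀ ≤ n → constantCoeff (a i) ^ n ∈ 𝔞 ^ l by
      simpa [IsTopologicallyNilpotent, 𝔞.hasBasis_nhds_zero_adic.tendsto_right_iff] using this
    intro l
    refine ⟨m * l, fun n hn => Ideal.pow_mem_of_pow_mem _ (m := m * l) ?_ hn⟩
    rw [pow_mul]
    exact Ideal.pow_mem_pow hm l
  have hc : Continuous (C : A →+* MvPowerSeries (Fin n) A) := WithPiTopology.continuous_C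
  refine ⟨eval₂Hom hc hE, fun r => ?_, fun i => ?_, fun f => ?_⟩
  · rw [coe_eval₂Hom]
    exact eval₂_C ..
  · rw [coe_eval₂Hom]
    exact eval₂_X ..
  · rw [coe_eval₂Hom]
    rfl

end MvPowerSeries

/-! ### Translations as ring homomorphisms. -/

namespace MvFormalGroup

open MvPowerSeries

variable {n : ℕ} {k : Type*} [CommRing k] (G : MvFormalGroup n k)

/-- The family `xⱼ ∘ (x + g)` of power series defining translation by `g`. -/
noncomputable def shift {A : Type*} [CommRing A] (𝔞 : Ideal A) (φ : k →+* A)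
    (g : AdicPoint n 𝔞) (j : Fin n) : MvPowerSeries (Fin n) A :=
  adicEval 𝔞 (Sum.elim MvPowerSeries.X (fun i => MvPowerSeries.C (g i : A))) ((G.mul j).map φ)

section

variable {A : Type*} [CommRing A] (𝔞 : Ideal A) [IsAdicComplete 𝔞 A] (φ : k →+* A)
  (g : AdicPoint n 𝔞)

theorem exists_ringHom_eq_adicEval_point :
    ∃ e : MvPowerSeries (Fin n ⊕ Fin n) A →+* MvPowerSeries (Fin n) A,
      (∀ r, e (C r) = C r) ∧ (∀ i, e (X (Sum.inl i)) = X i) ∧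
      (∀ i, e (X (Sum.inr i)) = C (g i : A)) ∧
      ∀ j, G.shift 𝔞 φ g j = e ((G.mul j).map φ) := by
  obtain ⟨e, hC, hX, he⟩ := exists_ringHom_eq_adicEval 𝔞
    (Sum.elim MvPowerSeries.X (fun i => MvPowerSeries.C (g i : A)))
    (by rintro (i | i) <;> simp)
  exact ⟨e, hC, fun i => by simp [hX], fun i => by simp [hX], fun j => he _⟩

/-- Translation by `g` is the identity modulo any ideal containing the coordinates of `g`. -/
theorem map_shift {B : Type*} [CommRing B] (π : A →+* B) (hg : ∀ i, π (g i) = 0) (j : Fin n) :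
    (G.shift 𝔞 φ g j).map π = X j := by
  obtain ⟨e, hC, hl, hr, he⟩ := G.exists_ringHom_eq_adicEval_point 𝔞 φ g
  have hs : HasSubst (Sum.elim X 0 : Fin n ⊕ Fin n → MvPowerSeries (Fin n) k) :=
    hasSubst_of_constantCoeff_zero (by rintro (i | i) <;> simp)
  let S : MvPowerSeries (Fin n ⊕ Fin n) k →+* MvPowerSeries (Fin n) k :=
    (substAlgHom (R := k) hs).toRingHom
  have hS : ∀ f, S f = subst (Sum.elim X 0 : Fin n ⊕ Fin n → MvPowerSeries (Fin n) k) f :=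
    fun f => congr_fun (coe_substAlgHom hs) f
  have hSC : ∀ a, S (C a) = C a := fun a => AlgHom.commutes (substAlgHom (R := k) hs) a
  -- Once g is killed, evaluation at (x, g) becomes the substitution (x, 0), where the right unit
  -- law gives x.
  have key : ((map π).comp e).comp (map φ) = (map (π.comp φ)).comp S := by
    refine ringHom_ext_of_constantCoeff (⊥ : Ideal B) (fun a => ?_) ?_ ?_
    · simp [hC, hSC]
    · rintro (i | i)
      · simp [hl, hS, subst_X hs]
      · simp [hr, hg, hS, subst_X hs]
    · rintro (i | i)
      · simp [hl]
      · simp [hr, hg]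
  have := RingHom.congr_fun key (G.mul j)
  simp only [RingHom.comp_apply, ← he] at this
  rw [this, hS, G.mul_zero j, map_X]

theorem constantCoeff_shift_mem (j : Fin n) : constantCoeff (G.shift 𝔞 φ g j) ∈ 𝔞.radical := by
  have := G.map_shift 𝔞 φ g (Ideal.Quotient.mk 𝔞.radical)
    (fun i => Ideal.Quotient.eq_zero_iff_mem.2 (g i).2) j
  rw [← Ideal.Quotient.eq_zero_iff_mem, ← constantCoeff_map, this, constantCoeff_X]

theorem exists_ringHom_eq_translation :
    ∃ τ : MvPowerSeries (Fin n) A →+* MvPowerSeries (Fin n) A,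
      (∀ r, τ (C r) = C r) ∧ (∀ i, τ (X i) = G.shift 𝔞 φ g i) ∧
      ∀ f, G.translation 𝔞 φ g f = τ f :=
  exists_ringHom_eq_adicEval 𝔞 _ (G.constantCoeff_shift_mem 𝔞 φ g)

/-- The translation `f ↦ f(x + g)` as a ring homomorphism. -/
noncomputable def translationHom : MvPowerSeries (Fin n) A →+* MvPowerSeries (Fin n) A :=
  (G.exists_ringHom_eq_translation 𝔞 φ g).choose

theorem translationHom_C (r : A) : G.translationHom 𝔞 φ g (C r) = C r :=
  (G.exists_ringHom_eq_translation 𝔞 φ g).choose_spec.1 r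

theorem translationHom_X (i : Fin n) : G.translationHom 𝔞 φ g (X i) = G.shift 𝔞 φ g i :=
  (G.exists_ringHom_eq_translation 𝔞 φ g).choose_spec.2.1 i

theorem translation_eq (f : MvPowerSeries (Fin n) A) :
    G.translation 𝔞 φ g f = G.translationHom 𝔞 φ g f :=
  (G.exists_ringHom_eq_translation 𝔞 φ g).choose_spec.2.2 f

theorem translate_eq_comap (I : Ideal (MvPowerSeries (Fin n) A)) :
    G.translate 𝔞 φ g I = I.comap (G.translationHom 𝔞 φ g) := by
  have : {f | G.translation 𝔞 φ g f ∈ I} =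
      (I.comap (G.translationHom 𝔞 φ g) : Set (MvPowerSeries (Fin n) A)) := by
    ext f
    simp [translation_eq]
  rw [translate, this, Ideal.span_eq]

theorem map_translationHom_of_eq_zero {B : Type*} [CommRing B] (π : A →+* B)
    (hg : ∀ i, π (g i) = 0) (f : MvPowerSeries (Fin n) A) :
    (G.translationHom 𝔞 φ g f).map π = f.map π := by
  have : (map π).comp (G.translationHom 𝔞 φ g) = map π := by
    refine ringHom_ext_of_constantCoeff (⊥ : Ideal B) (fun a => ?_) (fun i => ?_) (fun i => ?_)
    · simp [translationHom_C]
    · rw [RingHom.comp_apply, translationHom_X, map_shift _ _ _ _ _ hg, map_X]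
    · rw [RingHom.comp_apply, translationHom_X, map_shift _ _ _ _ _ hg, constantCoeff_X]
      exact zero_mem _
  exact RingHom.congr_fun this f

/-- Translation commutes with base change. -/
theorem map_translationHom {B : Type*} [CommRing B] (𝔟 : Ideal B) [IsAdicComplete 𝔟 B]
    (g' : AdicPoint n 𝔟) (h : A →+* B) (hg : ∀ i, h (g i) = g' i)
    (f : MvPowerSeries (Fin n) A) :
    (G.translationHom 𝔞 φ g f).map h = G.translationHom 𝔟 (h.comp φ) g' (f.map h) := by
  obtain ⟨e, hC, hl, hr, he⟩ := G.exists_ringHom_eq_adicEval_point 𝔞 φ g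
  obtain ⟨e', hC', hl', hr', he'⟩ := G.exists_ringHom_eq_adicEval_point 𝔟 (h.comp φ) g'
  have key : (map h).comp e = e'.comp (map h) := by
    refine ringHom_ext_of_constantCoeff 𝔟 (fun a => ?_) ?_ ?_
    · simp [hC, hC']
    · rintro (i | i)
      · simp [hl, hl']
      · simp [hr, hr', hg]
    · rintro (i | i)
      · simp [hl]
      · simp [hr, hg]
  have hshift : ∀ j, (G.shift 𝔞 φ g j).map h = G.shift 𝔟 (h.comp φ) g' j := by
    intro j
    have := RingHom.congr_fun key ((G.mul j).map φ)
    rw [he, he']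
    simpa using this
  have : (map h).comp (G.translationHom 𝔞 φ g) =
      (G.translationHom 𝔟 (h.comp φ) g').comp (map h) := by
    refine ringHom_ext_of_constantCoeff 𝔟 (fun a => ?_) (fun i => ?_) (fun i => ?_)
    · simp [translationHom_C]
    · simp [translationHom_X, hshift]
    · rw [RingHom.comp_apply, translationHom_X, hshift]
      exact G.constantCoeff_shift_mem ..
  exact RingHom.congr_fun this f

end

end MvFormalGroup

/-! ### Division by ideals of power series over a field, after extension of scalars. -/

namespace MvPowerSeries

section Functionals

variable {σ R A : Type*} [CommRing R] [CommRing A] [Algebra R A]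

/-- Apply a linear functional to all coefficients of a power series. -/
def mapLinear (φ : A →ₗ[R] R) (f : MvPowerSeries σ A) : MvPowerSeries σ R :=
  fun d => φ (coeff d f)

theorem coeff_mapLinear (φ : A →ₗ[R] R) (f : MvPowerSeries σ A) (d : σ →₀ ℕ) :
    coeff d (mapLinear φ f) = φ (coeff d f) := rfl

theorem mapLinear_mul_map (φ : A →ₗ[R] R) (h : MvPowerSeries σ A) (f : MvPowerSeries σ R) :
    mapLinear φ (h * f.map (algebraMap R A)) = mapLinear φ h * f := by
  classical
  ext d
  simp only [coeff_mapLinear, coeff_mul, map_sum, coeff_map]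
  refine Finset.sum_congr rfl fun p _ => ?_
  rw [mul_comm, ← Algebra.smul_def, map_smul, smul_eq_mul, mul_comm]

/-- `mapLinear φ` is linear over R⟦x⟧, so functionals descend membership in extended ideals. The
induction treats all multiples of f at once because the extended ideal is spanned over A⟦x⟧, where
`mapLinear φ` is not linear. -/
theorem mapLinear_mem (φ : A →ₗ[R] R) {I : Ideal (MvPowerSeries σ R)} {f : MvPowerSeries σ A}
    (hf : f ∈ I.map (map (algebraMap R A))) : mapLinear φ f ∈ I := by
  have hadd : ∀ x y : MvPowerSeries σ A, mapLinear φ (x + y) = mapLinear φ x + mapLinear φ y :=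
    fun x y => by ext d; simp [coeff_mapLinear]
  suffices h : ∀ x : MvPowerSeries σ A, mapLinear φ (x * f) ∈ I by simpa using h 1
  rw [Ideal.map] at hf
  refine Submodule.span_induction (p := fun f _ => ∀ x, mapLinear φ (x * f) ∈ I)
    ?_ ?_ ?_ ?_ hf
  · rintro _ ⟨y, hy, rfl⟩ x
    rw [mapLinear_mul_map]
    exact I.mul_mem_left _ hy
  · intro x
    have : mapLinear φ (x * 0) = 0 := by ext d; simp [coeff_mapLinear]
    rw [this]
    exact zero_mem _
  · intro y z _ _ hy hz x
    rw [mul_add, hadd]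
    exact add_mem (hy x) (hz x)
  · intro a y _ hy x
    rw [smul_eq_mul, ← mul_assoc]
    exact hy _

end Functionals

section StandardMonomials

variable {σ : Type*} {k : Type*} [Field k]

/-- The exponents of the lowest terms of the elements of an ideal `I` of a power series ring. -/
def leadingExponents (m : MonomialOrder σ) (I : Ideal (MvPowerSeries σ k)) : Set (σ →₀ ℕ) :=
  {α | ∃ f ∈ I, coeff α f = 1 ∧ ∀ β, m.toSyn β < m.toSyn α → coeff β f = 0}

variable (m : MonomialOrder σ) (I : Ideal (MvPowerSeries σ k))

/-- The monomial order is a well-order, so the support has a least exponent; dividing by its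
coefficient normalizes the lowest term. -/
theorem exists_mem_leadingExponents {f : MvPowerSeries σ k} (hf : f ∈ I) (h0 : f ≠ 0) :
    ∃ α ∈ leadingExponents m I, coeff α f ≠ 0 := by
  have hwf : WellFounded fun a b : σ →₀ ℕ => m.toSyn a < m.toSyn b :=
    InvImage.wf m.toSyn wellFounded_lt
  have hne : {α | coeff α f ≠ 0}.Nonempty := by
    by_contra h
    apply h0
    ext α
    by_contra hα
    exact h ⟨α, hα⟩
  have hmin := hwf.min_mem _ hne
  refine ⟨hwf.min _ hne, ⟨C (coeff (hwf.min _ hne) f)⁻¹ * f, I.mul_mem_left _ hf, ?_, ?_⟩, hmin⟩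
  · rw [coeff_C_mul]
    exact inv_mul_cancel₀ hmin
  · intro β hβ
    rw [coeff_C_mul]
    by_contra h
    exact hwf.not_lt_min _ (x := β) (right_ne_zero_of_mul h) hβ

/-- This is uniqueness of remainders. A nonzero coefficient is seen by some k-linear functional on
A, which reduces the claim to A = k. -/
theorem eq_zero_of_mem_map {A : Type*} [CommRing A] [Algebra k A] {f : MvPowerSeries σ A}
    (hf : f ∈ I.map (map (algebraMap k A))) (h0 : ∀ α ∈ leadingExponents m I, coeff α f = 0) :
    f = 0 := by
  ext d
  rw [coeff_zero]
  by_contra hd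
  obtain ⟨φ, hφ⟩ : ∃ φ : Module.Dual k A, φ (coeff d f) ≠ 0 := by
    by_contra! h
    exact hd ((Module.forall_dual_apply_eq_zero_iff k _).1 h)
  have hne : mapLinear φ f ≠ 0 := fun h => hφ (by rw [← coeff_mapLinear, h, coeff_zero])
  obtain ⟨α, hα, h⟩ := exists_mem_leadingExponents m I (mapLinear_mem φ hf) hne
  exact h (by rw [coeff_mapLinear, h0 α hα, map_zero])

/-- Dickson's lemma: the minimal elements form an antichain in a well-quasi-order. -/
theorem exists_finset_le_of_mem [Finite σ] (U : Set (σ →₀ ℕ)) :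
    ∃ B : Finset (σ →₀ ℕ), (∀ β ∈ B, β ∈ U) ∧ ∀ α ∈ U, ∃ β ∈ B, β ≤ α := by
  have hfin : {β | Minimal (· ∈ U) β}.Finite :=
    (setOfPred_minimal_antichain _).finite_of_partiallyWellOrderedOn
      (Set.isPWO_of_wellQuasiOrderedLE _)
  refine ⟨hfin.toFinset, fun β hβ => (hfin.mem_toFinset.1 hβ).prop, fun α hα => ?_⟩
  obtain ⟨β, hle, hβ⟩ := exists_minimal_le_of_wellFoundedLT (· ∈ U) α hα
  exact ⟨β, hfin.mem_toFinset.2 hβ, hle⟩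

/-- Division with remainder by an ideal of `k⟦x⟧` in the power series over a `k`-algebra. -/
theorem exists_sub_mem_map [Finite σ] {A : Type*} [CommRing A] [Algebra k A]
    (f : MvPowerSeries σ A) :
    ∃ r : MvPowerSeries σ A, (∀ α ∈ leadingExponents m I, coeff α r = 0) ∧
      f - r ∈ I.map (map (algebraMap k A)) := by
  classical
  set U := leadingExponents m I with hU
  obtain ⟨B, hBU, hB⟩ := exists_finset_le_of_mem U
  have hb : ∀ α, ∃ β, α ∈ U → β ∈ B ∧ β ≤ α := fun α => by
    by_cases h : α ∈ U
    · obtain ⟨β, h1, h2⟩ := hB α h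
      exact ⟨β, fun _ => ⟨h1, h2⟩⟩
    · exact ⟨0, fun h' => absurd h' h⟩
  choose b hb using hb
  have hF : ∀ β, ∃ F : MvPowerSeries σ k, β ∈ U → F ∈ I ∧ coeff β F = 1 ∧
      ∀ β', m.toSyn β' < m.toSyn β → coeff β' F = 0 := fun β => by
    by_cases h : β ∈ U
    · obtain ⟨F, h⟩ := h
      exact ⟨F, fun _ => h⟩
    · exact ⟨0, fun h' => absurd h' h⟩
  choose F hF using hF
  have hwf : WellFounded fun a b : σ →₀ ℕ => m.toSyn a < m.toSyn b :=
    InvImage.wf m.toSyn wellFounded_lt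
  -- Each α ∈ U is charged to the single divisor `b α`, and c α is the quotient coefficient needed
  -- to cancel f at α once the smaller exponents have been treated; hence the well-founded
  -- recursion. Values at α ∉ U are harmless, since nothing has to cancel there.
  obtain ⟨c, hc⟩ : ∃ c : (σ →₀ ℕ) → A, ∀ α, c α = coeff α f -
      ∑ β ∈ B, ∑ p ∈ Finset.HasAntidiagonal.antidiagonal α, if m.toSyn (p.1 + β) < m.toSyn α then
        (if b (p.1 + β) = β then c (p.1 + β) else 0) * algebraMap k A (coeff p.2 (F β)) else 0 := by
    refine ⟨hwf.fix fun α ih => coeff α f -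
      ∑ β ∈ B, ∑ p ∈ Finset.HasAntidiagonal.antidiagonal α,
        if h : m.toSyn (p.1 + β) < m.toSyn α then
        (if b (p.1 + β) = β then ih (p.1 + β) h else 0) * algebraMap k A (coeff p.2 (F β)) else 0,
      fun α => ?_⟩
    rw [WellFounded.fix_eq]
    simp only [dite_eq_ite]
  let q : (σ →₀ ℕ) → MvPowerSeries σ A := fun β u => if b (u + β) = β then c (u + β) else 0
  have hq : ∀ β u, coeff u (q β) = if b (u + β) = β then c (u + β) else 0 := fun _ _ => rfl
  let s : MvPowerSeries σ A := ∑ β ∈ B, q β * (F β).map (algebraMap k A)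
  refine ⟨f - s, fun α hα => ?_, ?_⟩
  · rw [map_sub, sub_eq_zero]
    have hterm : ∀ β ∈ B, ∀ p ∈ Finset.HasAntidiagonal.antidiagonal α,
        coeff p.1 (q β) * coeff p.2 ((F β).map (algebraMap k A)) =
          (if m.toSyn (p.1 + β) < m.toSyn α then
            (if b (p.1 + β) = β then c (p.1 + β) else 0) *
              algebraMap k A (coeff p.2 (F β)) else 0) +
          if b α = β ∧ p = (α - β, β) then c α else 0 := by
      intro β hβ p hp
      rw [Finset.HasAntidiagonal.mem_antidiagonal] at hp
      rw [hq, coeff_map]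
      -- A product of exponents p.1 and p.2 contributes a term of the recursion if p.1 + β is below
      -- α, the new coefficient c α if it equals α, and nothing if it is above, for then p.2
      -- precedes the lowest exponent β of F β.
      rcases lt_trichotomy (m.toSyn (p.1 + β)) (m.toSyn α) with h | h | h
      · have hn : ¬(b α = β ∧ p = (α - β, β)) := by
          rintro ⟨-, rfl⟩
          rw [hp] at h
          exact lt_irrefl _ h
        rw [if_pos h, if_neg hn, add_zero]
      · have h' : p.1 + β = α := m.toSyn.injective h
        have h2 : p.2 = β := by
          rw [← hp] at h'
          exact (add_left_cancel h').symm
        have h1 : p = (α - β, β) := by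
          ext1
          · simp [← h']
          · exact h2
        rw [if_neg h.not_lt, zero_add, h2, (hF β (hBU β hβ)).2.1, map_one, mul_one, h']
        by_cases h3 : b α = β
        · rw [if_pos h3, if_pos ⟨h3, h1⟩]
        · rw [if_neg h3, if_neg (fun h4 => h3 h4.1)]
      · have hn : ¬(b α = β ∧ p = (α - β, β)) := by
          rintro ⟨-, rfl⟩
          rw [hp] at h
          exact lt_irrefl _ h
        rw [if_neg h.le.not_gt, zero_add, if_neg hn, (hF β (hBU β hβ)).2.2 p.2, map_zero, mul_zero]
        rw [← hp, map_add, map_add] at h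
        exact lt_of_add_lt_add_left h
    have hs : coeff α s = ∑ β ∈ B, ∑ p ∈ Finset.HasAntidiagonal.antidiagonal α,
        coeff p.1 (q β) * coeff p.2 ((F β).map (algebraMap k A)) := by
      simp only [s, map_sum, coeff_mul]
    rw [hs, Finset.sum_congr rfl fun β hβ => Finset.sum_congr rfl (hterm β hβ)]
    simp only [Finset.sum_add_distrib]
    rw [← sub_eq_iff_eq_add', ← hc]
    obtain ⟨h1, h2⟩ := hb α hα
    rw [Finset.sum_eq_single_of_mem _ h1, Finset.sum_eq_single_of_mem (α - b α, b α)]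
    · simp
    · simp [Finset.HasAntidiagonal.mem_antidiagonal, tsub_add_cancel_of_le h2]
    · intro p _ hp
      simp [hp]
    · intro β _ hβ
      simp [hβ.symm]
  · rw [sub_sub_cancel]
    exact sum_mem fun β hβ => Ideal.mul_mem_left _ _
      (Ideal.mem_map_of_mem _ (hF β (hBU β hβ)).1)

end StandardMonomials

end MvPowerSeries

/-! ### Adic completeness of products. -/

section AdicComplete

theorem mem_span_singleton_pow_smul_top {R M : Type*} [CommRing R] [AddCommGroup M] [Module R M]
    {t : R} {n : ℕ} {x : M} :
    x ∈ (Ideal.span {t} ^ n • ⊤ : Submodule R M) ↔ ∃ y, t ^ n • y = x := by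
  rw [Ideal.span_singleton_pow, Submodule.ideal_span_singleton_smul]
  simp [Submodule.mem_smul_pointwise_iff_exists]

/-- A product of `t`-adically complete modules is `t`-adically complete. -/
theorem IsAdicComplete.pi_of_span_singleton {R M ι : Type*} [CommRing R] [AddCommGroup M]
    [Module R M] (t : R) [IsAdicComplete (Ideal.span {t}) M] :
    IsAdicComplete (Ideal.span {t}) (ι → M) where
  haus' x hx := by
    ext i
    rw [IsHausdorff.eq_iff_smodEq (I := Ideal.span {t})]
    intro n
    have := hx n
    rw [SModEq.zero, mem_span_singleton_pow_smul_top] at this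
    obtain ⟨y, hy⟩ := this
    rw [Pi.zero_apply, SModEq.zero, mem_span_singleton_pow_smul_top]
    exact ⟨y i, congr_fun hy i⟩
  prec' f hf := by
    have h : ∀ i, ∃ L : M, ∀ n, f n i ≡ L [SMOD (Ideal.span {t} ^ n • ⊤ : Submodule R M)] := by
      intro i
      refine IsPrecomplete.prec' (fun n => f n i) fun {m n} hmn => ?_
      have := hf hmn
      rw [SModEq.sub_mem, mem_span_singleton_pow_smul_top] at this
      obtain ⟨y, hy⟩ := this
      rw [SModEq.sub_mem, mem_span_singleton_pow_smul_top]
      exact ⟨y i, congr_fun hy i⟩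
    choose L hL using h
    refine ⟨L, fun n => ?_⟩
    have : ∀ i, ∃ y, t ^ n • y = f n i - L i := fun i => by
      rw [← mem_span_singleton_pow_smul_top, ← SModEq.sub_mem]
      exact hL i n
    choose y hy using this
    rw [SModEq.sub_mem, mem_span_singleton_pow_smul_top]
    exact ⟨y, funext hy⟩

instance MvPowerSeries.isAdicComplete_span_singleton {R M σ : Type*} [CommRing R] [CommRing M]
    [Algebra R M] (t : R) [IsAdicComplete (Ideal.span {t}) M] :
    IsAdicComplete (Ideal.span {t}) (MvPowerSeries σ M) :=
  IsAdicComplete.pi_of_span_singleton (M := M) t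

end AdicComplete

/-! ### Perturbations of the identity. -/

section Contraction

variable {A M : Type*} [CommRing A] [AddCommGroup M] [Module A M]

/-- From c = D (T c) - D (T c - c): the first term is in 𝔠M, and T - 1 raises the power of 𝔫 by one
while D preserves every 𝔟M. In use, D is a projection onto remainders and T a translation or its
inverse. -/
theorem mem_of_isNearIdentity {D T : M →ₗ[A] M} {𝔫 𝔠 : Ideal A}
    (hT : ∀ m, T m - m ∈ (𝔫 • ⊤ : Submodule A M)) {c : M} (hc : D c = c)
    (hTc : D (T c) ∈ (𝔠 • ⊤ : Submodule A M)) (l : ℕ) :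
    c ∈ (𝔫 ^ l • ⊤ ⊔ 𝔠 • ⊤ : Submodule A M) := by
  have hmap : ∀ (f : M →ₗ[A] M) (𝔟 : Ideal A), ((𝔟 • ⊤ : Submodule A M)).map f ≤ 𝔟 • ⊤ :=
    fun f 𝔟 => by
      rw [Submodule.map_smul'']
      exact Submodule.smul_mono le_rfl le_top
  induction l with
  | zero => simp
  | succ l ih =>
    have h1 : T c - c ∈ (𝔫 ^ (l + 1) • ⊤ ⊔ 𝔠 • ⊤ : Submodule A M) := by
      have h2 := Submodule.mem_map_of_mem (f := T - LinearMap.id) ih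
      rw [Submodule.map_sup, Submodule.map_smul''] at h2
      refine (sup_le_sup ?_ (hmap _ _)) h2
      rw [pow_succ, Submodule.mul_smul]
      refine Submodule.smul_mono le_rfl ?_
      rintro _ ⟨m, -, rfl⟩
      exact hT m
    have h3 : D (T c - c) ∈ (𝔫 ^ (l + 1) • ⊤ ⊔ 𝔠 • ⊤ : Submodule A M) := by
      have := Submodule.mem_map_of_mem (f := D) h1
      rw [Submodule.map_sup] at this
      exact sup_le_sup (hmap _ _) (hmap _ _) this
    have h4 : c = D (T c) - D (T c - c) := by
      rw [map_sub, hc]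
      abel
    rw [h4]
    exact sub_mem (Submodule.mem_sup_right hTc) h3

theorem eq_zero_of_isNearIdentity {D T : M →ₗ[A] M} {𝔫 𝔞 : Ideal A} [IsHausdorff 𝔞 M]
    {l : ℕ} (hl : 𝔫 ^ l ≤ 𝔞) (hT : ∀ m, T m - m ∈ (𝔫 • ⊤ : Submodule A M)) {c : M}
    (hc : D c = c) (hTc : D (T c) = 0) : c = 0 := by
  rw [IsHausdorff.eq_iff_smodEq (I := 𝔞)]
  intro j
  have := mem_of_isNearIdentity (𝔠 := ⊥) hT hc (by simp [hTc]) (l * j)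
  rw [Submodule.bot_smul, sup_bot_eq, pow_mul] at this
  rw [SModEq.zero]
  exact Submodule.smul_mono_left (Ideal.pow_right_mono hl j) this

/-- Injectivity is contraction with D = id. For surjectivity, the finite geometric series in 1 - T
inverts T modulo 𝔞, and completeness lifts this. -/
theorem bijective_of_isNearIdentity {T : M →ₗ[A] M} {𝔫 𝔞 : Ideal A} [IsAdicComplete 𝔞 M]
    {l : ℕ} (hl : 𝔫 ^ l ≤ 𝔞) (hT : ∀ m, T m - m ∈ (𝔫 • ⊤ : Submodule A M)) :
    Function.Bijective T := by
  constructor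
  · rw [← LinearMap.ker_eq_bot, LinearMap.ker_eq_bot']
    exact fun m hm => eq_zero_of_isNearIdentity (D := LinearMap.id) hl hT rfl hm
  · refine surjective_of_mkQ_comp_surjective (I := 𝔞) fun y => ?_
    obtain ⟨m, rfl⟩ := Submodule.mkQ_surjective _ y
    let E : Module.End A M := 1 - T
    have hE : ∀ j, ∀ x, (E ^ j) x ∈ (𝔫 ^ j • ⊤ : Submodule A M) := by
      intro j
      induction j with
      | zero => simp
      | succ j ih =>
        intro x
        rw [pow_succ' E, Module.End.mul_apply]
        have h2 := Submodule.mem_map_of_mem (f := E) (ih x)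
        rw [Submodule.map_smul''] at h2
        rw [pow_succ, Submodule.mul_smul]
        refine Submodule.smul_mono le_rfl ?_ h2
        rintro _ ⟨m, -, rfl⟩
        have : E m = -(T m - m) := by simp [E]
        rw [this]
        exact neg_mem (hT m)
    refine ⟨(∑ i ∈ Finset.range l, E ^ i) m, ?_⟩
    rw [LinearMap.comp_apply, ← sub_eq_zero, ← map_sub, Submodule.mkQ_apply,
      Submodule.Quotient.mk_eq_zero]
    have h1 : T * ∑ i ∈ Finset.range l, E ^ i = 1 - E ^ l := by
      rw [← mul_neg_geom_sum]
      simp [E]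
    have h2 : T ((∑ i ∈ Finset.range l, E ^ i) m) = m - (E ^ l) m := by
      rw [← Module.End.mul_apply, h1]
      simp
    rw [h2, sub_sub_cancel_left]
    exact neg_mem (Submodule.smul_mono_left hl (hE l m))

end Contraction

/-! ### Remainder projections, and division over a complete base. -/

namespace MvPowerSeries

/-- The power series with given coefficients. -/
def ofCoeff {σ A : Type*} (c : (σ →₀ ℕ) → A) : MvPowerSeries σ A := c

@[simp]
theorem coeff_ofCoeff {σ A : Type*} [Semiring A] (c : (σ →₀ ℕ) → A) (d : σ →₀ ℕ) :
    coeff d (ofCoeff c) = c d := rfl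

section Coefficients

variable {σ A : Type*} [CommRing A]

theorem coeff_mem_of_mem_smul_top {𝔟 : Ideal A} {f : MvPowerSeries σ A}
    (hf : f ∈ (𝔟 • ⊤ : Submodule A (MvPowerSeries σ A))) (d : σ →₀ ℕ) : coeff d f ∈ 𝔟 := by
  refine Submodule.smul_induction_on hf (fun a ha g _ => ?_) (fun x y hx hy => ?_)
  · rw [coeff_smul]
    exact 𝔟.mul_mem_right _ ha
  · rw [map_add]
    exact add_mem hx hy

/-- Infinitely many coefficients must be written with the same finitely many generators; this is
where finite generation enters. -/
theorem mem_smul_top_of_coeff_mem {𝔟 : Ideal A} (h𝔟 : 𝔟.FG) {f : MvPowerSeries σ A}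
    (hf : ∀ d, coeff d f ∈ 𝔟) : f ∈ (𝔟 • ⊤ : Submodule A (MvPowerSeries σ A)) := by
  obtain ⟨m, g, rfl⟩ := Submodule.fg_iff_exists_fin_generating_family.1 h𝔟
  have : ∀ d, ∃ c : Fin m → A, ∑ i, c i * g i = coeff d f := fun d =>
    Ideal.mem_span_range_iff_exists_fun.1 (hf d)
  choose c hc using this
  have hfc : f = ∑ i, g i • ofCoeff fun d => c d i := by
    ext d
    rw [← hc, map_sum]
    refine Finset.sum_congr rfl fun i _ => ?_
    rw [coeff_smul, mul_comm, coeff_ofCoeff]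
  rw [hfc]
  exact sum_mem fun i _ => Submodule.smul_mem_smul (Submodule.subset_span ⟨i, rfl⟩) trivial

end Coefficients

/-- The projection onto the power series without monomials in `U` along a complementary ideal. -/
theorem exists_projection {σ A : Type*} [CommRing A] (U : Set (σ →₀ ℕ))
    (Q : Ideal (MvPowerSeries σ A))
    (hex : ∀ f : MvPowerSeries σ A, ∃ r, (∀ α ∈ U, coeff α r = 0) ∧ f - r ∈ Q)
    (huniq : ∀ r ∈ Q, (∀ α ∈ U, coeff α r = 0) → r = 0) :
    ∃ D : MvPowerSeries σ A →ₗ[A] MvPowerSeries σ A, (∀ f, f - D f ∈ Q) ∧ (∀ f ∈ Q, D f = 0) ∧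
      (∀ r, (∀ α ∈ U, coeff α r = 0) → D r = r) ∧ ∀ f, ∀ α ∈ U, coeff α (D f) = 0 := by
  let W : Submodule A (MvPowerSeries σ A) :=
    { carrier := {r | ∀ α ∈ U, coeff α r = 0}
      add_mem' := fun {a b} ha hb α hα => by rw [map_add, ha α hα, hb α hα, add_zero]
      zero_mem' := fun α _ => coeff_zero α
      smul_mem' := fun c x hx α hα => by rw [coeff_smul, hx α hα, mul_zero] }
  let P : Submodule A (MvPowerSeries σ A) := Q.restrictScalars A
  have h : IsCompl W P := by
    refine ⟨Submodule.disjoint_def.2 fun x hx hx' => huniq x hx' hx, ?_⟩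
    rw [codisjoint_iff, eq_top_iff]
    intro f _
    obtain ⟨r, hr, hfr⟩ := hex f
    rw [← add_sub_cancel r f]
    exact Submodule.add_mem_sup hr hfr
  refine ⟨W.subtype ∘ₗ W.projectionOnto P h, fun f => ?_, fun f hf => ?_, fun r hr => ?_,
    fun f α hα => (W.projectionOnto P h f).2 α hα⟩
  · obtain ⟨r, hr, hfr⟩ := hex f
    have h1 : W.projectionOnto P h (f - r) = 0 :=
      Submodule.projectionOnto_apply_eq_zero_iff h |>.2 hfr
    have h2 : W.projectionOnto P h r = ⟨r, hr⟩ :=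
      Submodule.projectionOnto_apply_left h ⟨r, hr⟩
    rw [map_sub, sub_eq_zero, h2] at h1
    simpa [h1] using hfr
  · have : W.projectionOnto P h f = 0 :=
      Submodule.projectionOnto_apply_eq_zero_iff h |>.2 hf
    simp [this]
  · have h2 : W.projectionOnto P h r = ⟨r, hr⟩ :=
      Submodule.projectionOnto_apply_left h ⟨r, hr⟩
    simp [h2]

section Division

variable {R k S σ : Type*} [CommRing R] [Field k] [CommRing S] [Algebra R S]

theorem exists_eq_C_mul_of_dvd {t : S} {f : MvPowerSeries σ S} (h : ∀ d, t ∣ coeff d f) :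
    ∃ g, f = C t * g := by
  choose g hg using h
  exact ⟨ofCoeff g, by ext d; rw [coeff_C_mul, hg, coeff_ofCoeff]⟩

variable {t : R} {s : k →+* R} {res : R →+* k} (hs : ∀ a, res (s a) = a)
  (hker : RingHom.ker res = Ideal.span {t})

include hs hker in
theorem exists_map_eq_add_C_mul (f : MvPowerSeries σ R) :
    ∃ g, (f.map res).map s = f + C t * g := by
  obtain ⟨g, hg⟩ := exists_eq_C_mul_of_dvd (t := t) (f := (f.map res).map s - f) fun d => by
    rw [← Ideal.mem_span_singleton, ← hker, RingHom.mem_ker]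
    simp [hs]
  exact ⟨g, by rw [← hg]; abel⟩

include hs hker in
theorem map_reduction_le (I : Ideal (MvPowerSeries σ R)) :
    (I.map (map res)).map (map ((algebraMap R S).comp s)) ≤
      I.map (map (algebraMap R S)) ⊔ Ideal.span {C (algebraMap R S t)} := by
  rw [Ideal.map_map, Ideal.map_le_iff_le_comap]
  intro f hf
  obtain ⟨g, hg⟩ := exists_map_eq_add_C_mul hs hker f
  have : (map ((algebraMap R S).comp s)).comp (map res) f =
      f.map (algebraMap R S) + C (algebraMap R S t) * g.map (algebraMap R S) := by
    have h := congr_arg (map (algebraMap R S)) hg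
    rw [map_add, map_mul, map_C] at h
    rw [← h]
    ext d
    simp
  rw [Ideal.mem_comap, this]
  exact add_mem (Ideal.mem_sup_left (Ideal.mem_map_of_mem _ hf))
    (Ideal.mem_sup_right (Ideal.mul_mem_right _ _ (Ideal.mem_span_singleton_self _)))

include hs hker in
/-- Division with remainder by an ideal of `R⟦x⟧`, for a `t`-adically complete `R`-algebra `S`. -/
theorem exists_sub_mem_map_of_isAdicComplete [Finite σ] [IsNoetherianRing R]
    [IsAdicComplete (Ideal.span {t}) S] (m : MonomialOrder σ) (I : Ideal (MvPowerSeries σ R))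
    (f : MvPowerSeries σ S) :
    ∃ r : MvPowerSeries σ S, (∀ α ∈ leadingExponents m (I.map (map res)), coeff α r = 0) ∧
      f - r ∈ I.map (map (algebraMap R S)) := by
  classical
  set U := leadingExponents m (I.map (map res)) with hU
  obtain ⟨N, F, hF⟩ := Submodule.fg_iff_exists_fin_generating_family.1 (IsNoetherian.noetherian I)
  have hIS : I.map (map (algebraMap R S)) =
      Ideal.span (Set.range fun i => (F i).map (algebraMap R S)) := by
    rw [← hF]
    change Ideal.map _ (Ideal.span _) = _
    rw [Ideal.map_span, ← Set.range_comp]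
    rfl
  -- L sends (remainder, quotients) to remainder + Σ quotient · generator, after deleting the
  -- non-standard monomials of the `none` component. Division is surjectivity of L, which by
  -- completeness need only be checked modulo t.
  let L : (Option (Fin N) → MvPowerSeries σ S) →ₗ[R] MvPowerSeries σ S :=
    { toFun := fun q => ofCoeff (fun α => if α ∈ U then 0 else coeff α (q none)) +
        ∑ i, q (some i) * (F i).map (algebraMap R S)
      map_add' := fun q q' => by
        have : ofCoeff (fun α => if α ∈ U then 0 else coeff α ((q + q') none)) =
            ofCoeff (fun α => if α ∈ U then 0 else coeff α (q none)) +
            ofCoeff (fun α => if α ∈ U then 0 else coeff α (q' none)) := by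
          ext α
          simp only [map_add, coeff_ofCoeff]
          split_ifs <;> simp
        rw [this]
        simp only [Pi.add_apply, add_mul, Finset.sum_add_distrib]
        abel
      map_smul' := fun c q => by
        have : ofCoeff (fun α => if α ∈ U then 0 else coeff α ((c • q) none)) =
            c • ofCoeff (fun α => if α ∈ U then 0 else coeff α (q none)) := by
          ext α
          change (if α ∈ U then 0 else c • coeff α (q none)) =
            c • (if α ∈ U then 0 else coeff α (q none))
          split_ifs <;> simp
        rw [this, RingHom.id_apply, smul_add, Finset.smul_sum]
        simp only [Pi.smul_apply, smul_mul_assoc] }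
  have hL : ∀ q, L q = ofCoeff (fun α => if α ∈ U then 0 else coeff α (q none)) +
        ∑ i, q (some i) * (F i).map (algebraMap R S) := fun _ => rfl
  have hsurj : Function.Surjective L := by
    have : IsAdicComplete (Ideal.span {t}) (Option (Fin N) → MvPowerSeries σ S) :=
      IsAdicComplete.pi_of_span_singleton t
    refine surjective_of_mkQ_comp_surjective (I := Ideal.span {t}) fun y => ?_
    obtain ⟨f, rfl⟩ := Submodule.mkQ_surjective _ y
    -- Through the coefficient field S is a k-algebra, so division by I₀ is available; modulo t it
    -- is division by I.
    let : Algebra k S := ((algebraMap R S).comp s).toAlgebra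
    obtain ⟨r, hr, hfr⟩ := exists_sub_mem_map m (I.map (map res)) f
    have hfr' := map_reduction_le (S := S) hs hker I hfr
    rw [hIS] at hfr'
    obtain ⟨a, ha, b, hb, hab⟩ := Submodule.mem_sup.1 hfr'
    obtain ⟨q, hq⟩ := Ideal.mem_span_range_iff_exists_fun.1 ha
    obtain ⟨u, hu⟩ := Ideal.mem_span_singleton'.1 hb
    refine ⟨fun o => o.elim r q, ?_⟩
    have hLv : L (fun o => o.elim r q) = r + a := by
      rw [hL, ← hq]
      congr 1
      ext α
      rw [coeff_ofCoeff]
      split_ifs with h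
      · exact (hr α h).symm
      · rfl
    rw [LinearMap.comp_apply, ← sub_eq_zero, ← map_sub, Submodule.mkQ_apply,
      Submodule.Quotient.mk_eq_zero, hLv, ← pow_one (Ideal.span {t}),
      mem_span_singleton_pow_smul_top]
    refine ⟨-u, ?_⟩
    have h1 : f = r + a + b := by
      rw [add_assoc, hab]
      abel
    rw [h1, sub_add_cancel_left, ← hu, pow_one, smul_neg, Algebra.smul_def, algebraMap_apply,
      mul_comm]
  obtain ⟨q, rfl⟩ := hsurj f
  refine ⟨ofCoeff fun α => if α ∈ U then 0 else coeff α (q none), fun α hα => ?_, ?_⟩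
  · rw [coeff_ofCoeff, if_pos hα]
  rw [hL, add_sub_cancel_left, hIS]
  exact sum_mem fun i _ => Ideal.mul_mem_left _ _ (Ideal.subset_span ⟨i, rfl⟩)

end Division

end MvPowerSeries

/-! ### The integral closure of a complete discrete valuation ring in a finite extension. -/

section Complete

variable {R M : Type*} [CommRing R] [AddCommGroup M] [Module R M] {t : R}

/-- A separated module over a `t`-adically complete ring which is finitely generated modulo `t` is
finitely generated. -/
theorem Module.Finite.of_sup_smul_top_eq_top [IsAdicComplete (Ideal.span {t}) R]
    [IsHausdorff (Ideal.span {t}) M] {N : Submodule R M} (hN : N.FG)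
    (h : N ⊔ Ideal.span {t} • ⊤ = ⊤) : Module.Finite R M := by
  obtain ⟨m, b, hb⟩ := Submodule.fg_iff_exists_fin_generating_family.1 hN
  have : IsAdicComplete (Ideal.span {t}) (Fin m → R) := IsAdicComplete.pi_of_span_singleton t
  refine Module.Finite.of_surjective (Fintype.linearCombination R b)
    (surjective_of_mkQ_comp_surjective (I := Ideal.span {t}) fun y => ?_)
  obtain ⟨x, rfl⟩ := Submodule.mkQ_surjective _ y
  have hx : x ∈ N ⊔ Ideal.span {t} • ⊤ := by
    rw [h]
    trivial
  obtain ⟨a, ha, c, hc, rfl⟩ := Submodule.mem_sup.1 hx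
  rw [← hb, ← Fintype.range_linearCombination] at ha
  obtain ⟨q, rfl⟩ := ha
  refine ⟨q, ?_⟩
  rw [LinearMap.comp_apply, ← sub_eq_zero, ← map_sub, Submodule.mkQ_apply,
    Submodule.Quotient.mk_eq_zero, sub_add_cancel_left]
  exact neg_mem hc

theorem IsAdicComplete.of_free [Module.Finite R M] [Module.Free R M]
    [IsAdicComplete (Ideal.span {t}) R] : IsAdicComplete (Ideal.span {t}) M := by
  have : IsAdicComplete (Ideal.span {t}) (Module.Free.ChooseBasisIndex R M → R) :=
    IsAdicComplete.pi_of_span_singleton t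
  let e := (Module.Free.chooseBasis R M).equivFun
  have key : ∀ (n : ℕ) (x : M), x ∈ (Ideal.span {t} ^ n • ⊤ : Submodule R M) ↔
      e x ∈ (Ideal.span {t} ^ n • ⊤ : Submodule R (Module.Free.ChooseBasisIndex R M → R)) := by
    intro n x
    rw [mem_span_singleton_pow_smul_top, mem_span_singleton_pow_smul_top]
    constructor
    · rintro ⟨y, rfl⟩
      exact ⟨e y, by rw [map_smul]⟩
    · rintro ⟨y, hy⟩
      exact ⟨e.symm y, e.injective (by rw [map_smul, e.apply_symm_apply, hy])⟩
  exact
    { haus' := fun x hx => by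
        apply e.injective
        rw [map_zero, IsHausdorff.eq_iff_smodEq (I := Ideal.span {t})]
        intro n
        rw [SModEq.zero, ← key, ← SModEq.zero]
        exact hx n
      prec' := fun f hf => by
        obtain ⟨L, hL⟩ := IsPrecomplete.prec' (I := Ideal.span {t}) (fun n => e (f n))
          (fun {m n} hmn => by
            rw [SModEq.sub_mem, ← map_sub, ← key, ← SModEq.sub_mem]
            exact hf hmn)
        refine ⟨e.symm L, fun n => ?_⟩
        rw [SModEq.sub_mem, key, map_sub, e.apply_symm_apply, ← SModEq.sub_mem]
        exact hL n }

end Complete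

section IntegralClosure

variable {R K L : Type*} [CommRing R] [Field K] [Algebra R K] [IsFractionRing R K]
  [Field L] [Algebra K L] [Algebra R L] [IsScalarTower R K L]

include K in
theorem algebraMap_injective_of_field_tower : Function.Injective (algebraMap R L) := by
  rw [IsScalarTower.algebraMap_eq R K L]
  exact (algebraMap K L).injective.comp (IsFractionRing.injective R K)

variable [IsDomain R]

-- The quotient b / a in K is integral over R, hence in R. Congruences modulo t ^ N thus descend
-- from the extension to R.
include K in
theorem dvd_of_algebraMap_dvd_integralClosure [IsIntegrallyClosed R] {a b : R}
    (h : algebraMap R (integralClosure R L) a ∣ algebraMap R (integralClosure R L) b) : a ∣ b := by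
  have hinj := algebraMap_injective_of_field_tower (R := R) (K := K) (L := L)
  obtain ⟨z, hz⟩ := h
  have hz' : algebraMap R L b = algebraMap R L a * z := congr_arg Subtype.val hz
  rcases eq_or_ne a 0 with rfl | ha
  · rw [map_zero, zero_mul, ← map_zero (algebraMap R L)] at hz'
    rw [hinj hz']
  have ha' : algebraMap R K a ≠ 0 := by
    rwa [Ne, FaithfulSMul.algebraMap_eq_zero_iff]
  have h1 : algebraMap K L (algebraMap R K b / algebraMap R K a) = z := by
    rw [map_div₀, ← IsScalarTower.algebraMap_apply, ← IsScalarTower.algebraMap_apply, hz',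
      mul_div_cancel_left₀]
    rw [IsScalarTower.algebraMap_apply R K L]
    simpa using ha'
  have h2 : IsIntegral R (algebraMap R K b / algebraMap R K a) := by
    have h3 : IsIntegral R (z : L) := z.2
    rw [← h1] at h3
    exact (isIntegral_algHom_iff (IsScalarTower.toAlgHom R K L)
      (algebraMap K L).injective).1 h3
  obtain ⟨c, hc⟩ := IsIntegrallyClosed.isIntegral_iff.1 h2
  refine ⟨c, IsFractionRing.injective R K ?_⟩
  rw [map_mul, hc, mul_div_cancel₀ _ ha']

include K in
theorem isTorsionFree_integralClosure : Module.IsTorsionFree R (integralClosure R L) := by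
  rw [Module.isTorsionFree_iff_algebraMap_injective]
  intro a b h
  exact algebraMap_injective_of_field_tower (K := K) (congr_arg Subtype.val h)

variable [IsDiscreteValuationRing R] {t : R} (ht : Irreducible t)

-- A nonzero integral x divides some nonzero c in R; if every t ^ m divided x, every t ^ m would
-- divide c.
include ht K in
theorem isHausdorff_integralClosure :
    IsHausdorff (Ideal.span {t}) (integralClosure R L) where
  haus' x hx := by
    by_contra hx0
    have := isTorsionFree_integralClosure (R := R) (K := K) (L := L)
    have hxalg : IsAlgebraic R x := (integralClosure.isIntegral x).isAlgebraic
    obtain ⟨c, hc0, hc⟩ := hxalg.exists_nonzero_dvd (mem_nonZeroDivisors_of_ne_zero hx0)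
    have hne : Ideal.span {t} ≠ ⊤ := by
      rw [Ne, Ideal.span_singleton_eq_top]
      exact ht.not_isUnit
    have := IsHausdorff.of_isDomain _ hne
    refine hc0 ((IsHausdorff.eq_iff_smodEq (I := Ideal.span {t})).2 fun m => ?_)
    have h1 := hx m
    rw [SModEq.zero, mem_span_singleton_pow_smul_top] at h1
    obtain ⟨y, rfl⟩ := h1
    rw [SModEq.zero, smul_eq_mul, Ideal.mul_top, Ideal.span_singleton_pow,
      Ideal.mem_span_singleton]
    refine dvd_of_algebraMap_dvd_integralClosure (K := K) (L := L) ((Dvd.intro y ?_).trans hc)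
    rw [Algebra.smul_def]

-- The extension may be inseparable, so the argument avoids the trace form. A family independent
-- modulo t is independent over R (divide a relation by t repeatedly), so its size is at most the
-- degree. A family of maximal size generates modulo t, hence generates by completeness.
include ht K in
theorem finite_integralClosure [FiniteDimensional K L] [IsAdicComplete (Ideal.span {t}) R] :
    Module.Finite R (integralClosure R L) := by
  classical
  have hH := isHausdorff_integralClosure (K := K) (L := L) ht
  have htf := isTorsionFree_integralClosure (R := R) (K := K) (L := L)
  have hne : Ideal.span {t} ≠ ⊤ := by
    rw [Ne, Ideal.span_singleton_eq_top]
    exact ht.not_isUnit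
  -- a family of elements which is linearly independent modulo `t`
  let P : ℕ → Prop := fun m => ∃ e : Fin m → integralClosure R L, ∀ c : Fin m → R,
    (∃ y, ∑ i, c i • e i = t • y) → ∀ i, t ∣ c i
  have hbound : ∀ m, P m → m ≤ Module.finrank K L := by
    rintro m ⟨e, he⟩
    have hli : LinearIndependent R e := by
      rw [Fintype.linearIndependent_iff]
      have key : ∀ l : ℕ, ∀ c : Fin m → R, ∑ i, c i • e i = 0 → ∀ i, t ^ l ∣ c i := by
        intro l
        induction l with
        | zero => simp
        | succ l ih =>
          intro c hc
          choose c' hc' using he c ⟨0, by rw [hc, smul_zero]⟩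
          have h0 : ∑ i, c' i • e i = 0 := by
            have : t • ∑ i, c' i • e i = 0 := by
              rw [← hc, Finset.smul_sum]
              exact Finset.sum_congr rfl fun i _ => by rw [hc' i, mul_smul]
            exact (smul_eq_zero_iff_right ht.ne_zero).1 this
          intro i
          rw [hc' i, pow_succ']
          exact mul_dvd_mul_left _ (ih c' h0 i)
      intro c hc i
      refine (IsHausdorff.of_isDomain _ hne).haus _ fun l => ?_
      rw [SModEq.zero, smul_eq_mul, Ideal.mul_top, Ideal.span_singleton_pow,
        Ideal.mem_span_singleton]
      exact key l c hc i
    have hli' : LinearIndependent R fun i => (e i : L) :=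
      hli.map' (integralClosure R L).val.toLinearMap
        (LinearMap.ker_eq_bot.2 Subtype.val_injective)
    rw [LinearIndependent.iff_fractionRing R K] at hli'
    simpa using hli'.fintype_card_le_finrank
  have hP0 : P 0 := ⟨Fin.elim0, fun c _ i => i.elim0⟩
  obtain ⟨m, hm, hmax⟩ : ∃ m, P m ∧ ¬ P (m + 1) := by
    by_contra! h
    have : ∀ m, P m := fun m => Nat.rec hP0 (fun m hm => h m hm) m
    exact absurd (hbound _ (this (Module.finrank K L + 1))) (by omega)
  obtain ⟨e, he⟩ := hm
  refine Module.Finite.of_sup_smul_top_eq_top (t := t) (N := Submodule.span R (Set.range e))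
    (Submodule.fg_span (Set.finite_range e)) ?_
  rw [eq_top_iff]
  intro x _
  have hx : ∃ c : Fin (m + 1) → R,
      (∃ y, ∑ i, c i • (Fin.cons x e : Fin (m + 1) → integralClosure R L) i = t • y) ∧
        ∃ i, ¬ t ∣ c i := by
    by_contra! h
    exact hmax ⟨Fin.cons x e, fun c hc i => h c hc i⟩
  obtain ⟨c, ⟨y, hy⟩, i, hi⟩ := hx
  rw [Fin.sum_univ_succ] at hy
  simp only [Fin.cons_zero, Fin.cons_succ] at hy
  -- If t divided the coefficient of x, independence of e modulo t would make t divide all the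
  -- others too.
  have h0 : IsUnit (c 0) := by
    by_contra h0
    have h0' : t ∣ c 0 := by
      rw [← Ideal.mem_span_singleton, ← ht.maximalIdeal_eq]
      exact h0
    obtain ⟨c', hc'⟩ := h0'
    have h1 := he (fun i => c i.succ) ⟨y - c' • x, by
      rw [smul_sub, ← hy, hc', mul_smul, add_sub_cancel_left]⟩
    refine hi (Fin.cases ⟨c', hc'⟩ h1 i)
  obtain ⟨u, hu⟩ := h0
  have hx : x = (↑u⁻¹ : R) • (-∑ i : Fin m, c i.succ • e i) + t • (↑u⁻¹ : R) • y := by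
    rw [smul_comm t, ← smul_add, ← hy, neg_add_cancel_comm_assoc, ← hu, ← mul_smul,
      Units.inv_mul, one_smul]
  rw [hx]
  refine Submodule.add_mem_sup (Submodule.smul_mem _ _ (neg_mem (sum_mem fun i _ =>
    Submodule.smul_mem _ _ (Submodule.subset_span ⟨i, rfl⟩)))) ?_
  exact Submodule.smul_mem_smul (Ideal.mem_span_singleton_self t) trivial

include ht K in
theorem isAdicComplete_integralClosure [FiniteDimensional K L]
    [IsAdicComplete (Ideal.span {t}) R] :
    IsAdicComplete (Ideal.span {t}) (integralClosure R L) := by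
  have := finite_integralClosure (K := K) (L := L) ht
  have := isTorsionFree_integralClosure (R := R) (K := K) (L := L)
  exact IsAdicComplete.of_free

end IntegralClosure

/-! ### Points of the generic fibre. -/

/-- If an element `t ≠ 0` of a Noetherian local domain lies in the maximal ideal and in every
nonzero prime ideal, then the maximal ideal is the radical of `(t)`. -/
theorem IsLocalRing.maximalIdeal_le_radical_span_singleton {C : Type*} [CommRing C] [IsDomain C]
    [IsNoetherianRing C] [IsLocalRing C] {t : C} (ht0 : t ≠ 0)
    (ht : ∀ Q : Ideal C, Q.IsPrime → Q ≠ ⊥ → t ∈ Q) :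
    maximalIdeal C ≤ (Ideal.span {t}).radical := by
  classical
  rw [← Ideal.sInf_minimalPrimes]
  refine le_sInf fun P hP => ?_
  have hfin := Ideal.finite_minimalPrimes_of_isNoetherianRing C (Ideal.span {t})
  suffices h : ∃ P' ∈ (Ideal.span {t}).minimalPrimes, maximalIdeal C ≤ P' by
    obtain ⟨P', hP', hle⟩ := h
    have hPP' : P ≤ P' := (le_maximalIdeal hP.1.1.ne_top).trans hle
    exact hle.trans (hP'.2 hP.1 hPP')
  -- Otherwise prime avoidance gives x in the maximal ideal outside all minimal primes of (t). A
  -- minimal prime Q over x contains t, hence strictly contains some P' minimal over (t), and 0 < P'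
  -- < Q contradicts Krull's height bound for Q.
  by_contra! hcon
  have hnot : ¬ ((maximalIdeal C : Set C) ⊆
      ⋃ P ∈ (hfin.toFinset : Set (Ideal C)), (P : Set C)) := by
    intro hsub
    obtain ⟨i, hi, hle⟩ := (Ideal.subset_union_prime (f := fun P : Ideal C => P) ⊥ ⊥
      (fun i hi _ _ => (hfin.mem_toFinset.1 hi).1.1)).1 hsub
    exact hcon i (hfin.mem_toFinset.1 hi) hle
  obtain ⟨x, hx, hxn⟩ := Set.not_subset.1 hnot
  have hx' : ∀ P' ∈ (Ideal.span {t}).minimalPrimes, x ∉ P' := by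
    intro P' hP' hxP
    exact hxn (Set.mem_biUnion (hfin.mem_toFinset.2 hP') hxP)
  obtain ⟨Q, hQ, -⟩ := Ideal.exists_minimalPrimes_le
    ((Ideal.span_singleton_le_iff_mem _).2 hx)
  have := hQ.1.1
  have hxQ : x ∈ Q := hQ.1.2 (Ideal.mem_span_singleton_self x)
  have hQ0 : Q ≠ ⊥ := by
    rintro rfl
    rw [Ideal.mem_bot] at hxQ
    exact hx' P hP (hxQ ▸ zero_mem P)
  obtain ⟨P', hP', hP'Q⟩ := Ideal.exists_minimalPrimes_le
    ((Ideal.span_singleton_le_iff_mem _).2 (ht Q hQ.1.1 hQ0))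
  have := hP'.1.1
  have h1 : P' < Q := lt_of_le_of_ne hP'Q fun h => hx' P' hP' (h ▸ hxQ)
  have h2 : (⊥ : Ideal C) < P' := by
    refine bot_lt_iff_ne_bot.2 ?_
    rintro rfl
    exact ht0 (by simpa using hP'.1.2 (Ideal.mem_span_singleton_self t))
  have h3 := Ideal.height_le_one_of_isPrincipal_of_mem_minimalPrimes _ Q hQ
  have : (⊥ : Ideal C).IsPrime := Ideal.isPrime_bot
  have h4 := Ideal.height_strict_mono_of_isPrime_of_isPrime h1
  have h5 := Ideal.height_strict_mono_of_isPrime_of_isPrime h2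
  have h6 : (1 : ℕ∞) ≤ P'.height := Order.one_le_iff_pos.2 (lt_of_le_of_lt zero_le h5)
  exact absurd (h4.trans_le h3) (not_lt.2 h6)

namespace MvPowerSeries

section Points

variable {R σ : Type*} [CommRing R] [IsDomain R] [IsDiscreteValuationRing R] [Finite σ] {t : R}
  (ht : Irreducible t) [IsAdicComplete (Ideal.span {t}) R]

include ht in
/-- A quotient of `R⟦x⟧` whose generic fibre is not empty has a quotient domain finite
over `R` with the same property. -/
theorem exists_isPrime_finite_quotient (𝔞 : Ideal (MvPowerSeries σ R))
    (h𝔞 : ∀ N : ℕ, C t ^ N ∉ 𝔞) :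
    ∃ 𝔭 : Ideal (MvPowerSeries σ R), 𝔭.IsPrime ∧ 𝔞 ≤ 𝔭 ∧ C t ∉ 𝔭 ∧
      Module.Finite R (MvPowerSeries σ R ⧸ 𝔭) ∧
      ∀ i, Ideal.Quotient.mk 𝔭 (X i) ∈
        (Ideal.span {algebraMap R (MvPowerSeries σ R ⧸ 𝔭) t}).radical := by
  classical
  obtain ⟨𝔭₀, hp₀, hle₀, hd₀⟩ := Ideal.exists_le_prime_disjoint 𝔞
    (Submonoid.powers (C t : MvPowerSeries σ R)) (by
      rw [Set.disjoint_left]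
      rintro _ hx ⟨N, rfl⟩
      exact h𝔞 N hx)
  -- A prime maximal among those avoiding t: in the quotient t lies in every nonzero prime, so the
  -- maximal ideal is the radical of (t).
  obtain ⟨𝔭, ⟨hp, hle, hCt⟩, hmax⟩ : ∃ 𝔭 : Ideal (MvPowerSeries σ R),
      (𝔭.IsPrime ∧ 𝔞 ≤ 𝔭 ∧ C t ∉ 𝔭) ∧
      ∀ 𝔮 ∈ {𝔭 : Ideal (MvPowerSeries σ R) | 𝔭.IsPrime ∧ 𝔞 ≤ 𝔭 ∧ C t ∉ 𝔭}, ¬ 𝔭 < 𝔮 :=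
    set_has_maximal_iff_noetherian.2
    (inferInstance : IsNoetherian (MvPowerSeries σ R) (MvPowerSeries σ R))
    {𝔭 : Ideal (MvPowerSeries σ R) | 𝔭.IsPrime ∧ 𝔞 ≤ 𝔭 ∧ C t ∉ 𝔭}
    ⟨𝔭₀, hp₀, hle₀, fun h => Set.disjoint_left.1 hd₀ h ⟨1, pow_one _⟩⟩
  let Q := MvPowerSeries σ R ⧸ 𝔭
  have : IsLocalRing Q := IsLocalRing.of_surjective' _ Ideal.Quotient.mk_surjective
  have halg : algebraMap R Q t = Ideal.Quotient.mk 𝔭 (C t) := rfl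
  have ht0 : algebraMap R Q t ≠ 0 := by
    rw [halg, Ne, Ideal.Quotient.eq_zero_iff_mem]
    exact hCt
  have hrad := IsLocalRing.maximalIdeal_le_radical_span_singleton ht0 (fun P hP hP0 => by
    by_contra htP
    have hc := hmax (P.comap (Ideal.Quotient.mk 𝔭))
      ⟨Ideal.comap_isPrime _ _, hle.trans ?_, htP⟩
    · refine hc (lt_of_le_of_ne ?_ ?_)
      · intro x hx
        rw [Ideal.mem_comap, Ideal.Quotient.eq_zero_iff_mem.2 hx]
        exact zero_mem _
      · intro h
        apply hP0
        rw [eq_bot_iff]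
        intro y hy
        obtain ⟨x, rfl⟩ := Ideal.Quotient.mk_surjective y
        have : x ∈ 𝔭 := h ▸ hy
        exact Ideal.Quotient.eq_zero_iff_mem.2 this
    · intro x hx
      rw [Ideal.mem_comap, Ideal.Quotient.eq_zero_iff_mem.2 hx]
      exact zero_mem _)
  have hunit : ∀ z : MvPowerSeries σ R, ¬ IsUnit z → ¬ IsUnit (Ideal.Quotient.mk 𝔭 z) := by
    intro z hz hu
    obtain ⟨y, hy⟩ := isUnit_iff_exists_inv.1 hu
    obtain ⟨y, rfl⟩ := Ideal.Quotient.mk_surjective y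
    rw [← map_mul, ← map_one (Ideal.Quotient.mk 𝔭), Ideal.Quotient.eq] at hy
    have h1 := IsLocalRing.le_maximalIdeal hp.ne_top hy
    have h2 : z * y ∈ IsLocalRing.maximalIdeal (MvPowerSeries σ R) :=
      Ideal.mul_mem_right _ _ hz
    have h3 := sub_mem h2 h1
    rw [sub_sub_cancel] at h3
    exact h3 isUnit_one
  have hX : ∀ i, Ideal.Quotient.mk 𝔭 (X i) ∈ (Ideal.span {algebraMap R Q t}).radical := by
    intro i
    refine hrad (hunit _ ?_)
    rw [isUnit_iff_constantCoeff]
    simp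
  refine ⟨𝔭, hp, hle, hCt, ?_, hX⟩
  -- Monomials of degree at least M are divisible by t in the quotient, so polynomials of total
  -- degree at most M generate it modulo t.
  obtain ⟨M, hM⟩ : ∃ M, (Ideal.span (Set.range (X : σ → MvPowerSeries σ R))).map
      (Ideal.Quotient.mk 𝔭) ^ M ≤ Ideal.span {algebraMap R Q t} := by
    refine Ideal.exists_pow_le_of_le_radical_of_fg ?_ (IsNoetherian.noetherian _)
    rw [Ideal.map_span, Ideal.span_le]
    rintro _ ⟨_, ⟨i, rfl⟩, rfl⟩
    exact hX i
  have hne : Ideal.span {algebraMap R Q t} ≠ ⊤ := by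
    rw [Ne, Ideal.span_singleton_eq_top, halg]
    refine hunit _ ?_
    rw [isUnit_iff_constantCoeff, constantCoeff_C]
    exact ht.not_isUnit
  have : IsHausdorff (Ideal.span {t}) Q := by
    rw [← IsHausdorff.map_algebraMap_iff (S := Q), Ideal.map_span, Set.image_singleton]
    exact IsHausdorff.of_isDomain _ hne
  let ev : MvPolynomial σ R →ₗ[R] Q := (Ideal.Quotient.mkₐ R 𝔭).toLinearMap ∘ₗ
    (MvPolynomial.coeToMvPowerSeries.algHom (σ := σ) (R := R) R).toLinearMap
  refine Module.Finite.of_sup_smul_top_eq_top (t := t)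
    (N := (MvPolynomial.restrictTotalDegree σ R M).map ev)
    (Submodule.FG.map _ (Module.Finite.iff_fg.1 inferInstance)) ?_
  rw [eq_top_iff]
  intro y _
  obtain ⟨f, rfl⟩ := Ideal.Quotient.mk_surjective y
  have hf := hM (Ideal.map_pow (Ideal.Quotient.mk 𝔭) _ M ▸
    Ideal.mem_map_of_mem (Ideal.Quotient.mk 𝔭) (sub_truncTotal_mem f M))
  obtain ⟨u, hu⟩ := Ideal.mem_span_singleton'.1 hf
  have hf' : Ideal.Quotient.mk 𝔭 f = ev (truncTotal M f) + t • u := by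
    have h1 : t • u = u * algebraMap R Q t := (Algebra.smul_def t u).trans (mul_comm _ _)
    rw [h1, hu, map_sub]
    exact (add_sub_cancel _ _).symm
  rw [hf']
  refine Submodule.add_mem_sup (Submodule.mem_map_of_mem ?_)
    (Submodule.smul_mem_smul (Ideal.mem_span_singleton_self t) trivial)
  rw [MvPolynomial.mem_restrictTotalDegree]
  rcases eq_or_ne M 0 with rfl | hM0
  · have : truncTotal 0 f = 0 := by
      ext d
      rw [coeff_truncTotal_eq_zero _ (Nat.zero_le _), MvPolynomial.coeff_zero]
    simp [this]
  · exact (totalDegree_truncTotal_lt _ hM0).le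

variable {K Ω : Type*} [Field K] [Algebra R K] [IsFractionRing R K] [Field Ω] [Algebra K Ω]
  [Algebra R Ω] [IsScalarTower R K Ω] [IsAlgClosed Ω]

include ht in
/-- A closed subscheme of the formal affine space over a complete discrete valuation ring `R` whose
generic fibre is not empty has a point with values in the integral closure of `R` in a finite
extension of the fraction field. -/
theorem exists_point_of_pow_notMem [Algebra.IsAlgebraic K Ω] (𝔞 : Ideal (MvPowerSeries σ R))
    (h𝔞 : ∀ N : ℕ, C t ^ N ∉ 𝔞) :
    ∃ (K' : IntermediateField K Ω) (_ : FiniteDimensional K K')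
      (ψ : MvPowerSeries σ R →+* integralClosure R K'),
      (∀ r, ψ (C r) = algebraMap R _ r) ∧ (∀ f ∈ 𝔞, ψ f = 0) ∧
      ∀ i, ψ (X i) ∈ (Ideal.span {algebraMap R (integralClosure R K') t}).radical := by
  classical
  obtain ⟨𝔭, hp, hle, hCt, hfin, hX⟩ := exists_isPrime_finite_quotient ht 𝔞 h𝔞
  let Q := MvPowerSeries σ R ⧸ 𝔭
  have halg : ∀ r, algebraMap R Q r = Ideal.Quotient.mk 𝔭 (C r) := fun _ => rfl
  have : Module.IsTorsionFree R Q := by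
    rw [Module.isTorsionFree_iff_algebraMap_injective, injective_iff_map_eq_zero]
    intro r hr
    by_contra hr0
    obtain ⟨N, u, rfl⟩ := IsDiscreteValuationRing.eq_unit_mul_pow_irreducible hr0 ht
    rw [map_mul, map_pow, (u.isUnit.map (algebraMap R Q)).mul_right_eq_zero, halg, ← map_pow,
      Ideal.Quotient.eq_zero_iff_mem] at hr
    exact hCt (hp.mem_of_pow_mem N hr)
  have : Module.IsTorsionFree R Ω := by
    rw [Module.isTorsionFree_iff_algebraMap_injective]
    exact algebraMap_injective_of_field_tower (K := K)
  -- Q is a finite torsion-free domain over R, so it is algebraic and maps to Ω; finitely many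
  -- module generators then keep the image inside a finite extension of K.
  let ψ₀ : Q →ₐ[R] Ω := IsAlgClosed.lift
  obtain ⟨T, hT⟩ := Module.Finite.fg_top (R := R) (M := Q)
  have hint : ∀ q, IsIntegral R (ψ₀ q) := fun q => (Algebra.IsIntegral.isIntegral q).map ψ₀
  let K' : IntermediateField K Ω := IntermediateField.adjoin K (T.image ψ₀ : Finset Ω)
  have hK' : FiniteDimensional K K' := by
    refine IntermediateField.finiteDimensional_adjoin fun x _ => ?_
    exact (Algebra.IsAlgebraic.isAlgebraic x).isIntegral
  have hmem : ∀ q, ψ₀ q ∈ K' := by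
    intro q
    have hq : q ∈ Submodule.span R (T : Set Q) := hT ▸ trivial
    have hle : Submodule.span R (T : Set Q) ≤
        ((Subalgebra.restrictScalars R K'.toSubalgebra).comap ψ₀).toSubmodule := by
      rw [Submodule.span_le]
      intro x hx
      exact IntermediateField.subset_adjoin _ _ (Finset.mem_coe.2 (Finset.mem_image_of_mem _ hx))
    exact hle hq
  let ψ₁ : Q →ₐ[R] K' := 
    { toFun := fun q => ⟨ψ₀ q, hmem q⟩
      map_one' := Subtype.ext (map_one ψ₀)
      map_zero' := Subtype.ext (map_zero ψ₀)
      map_add' := fun a b => Subtype.ext (map_add ψ₀ a b)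
      map_mul' := fun a b => Subtype.ext (map_mul ψ₀ a b)
      commutes' := fun r => Subtype.ext (ψ₀.commutes r) }
  let ψ₂ : Q →ₐ[R] integralClosure R K' := ψ₁.codRestrict (integralClosure R K')
    fun q => (Algebra.IsIntegral.isIntegral q).map ψ₁
  refine ⟨K', hK', (ψ₂ : Q →+* _).comp (Ideal.Quotient.mk 𝔭), fun r => ψ₂.commutes r,
    fun f hf => ?_, fun i => ?_⟩
  · rw [RingHom.comp_apply, Ideal.Quotient.eq_zero_iff_mem.2 (hle hf), map_zero]
  · obtain ⟨N, hN⟩ := hX i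
    refine ⟨N, ?_⟩
    obtain ⟨u, hu⟩ := Ideal.mem_span_singleton'.1 hN
    rw [RingHom.comp_apply, ← map_pow, ← hu, map_mul, Ideal.mem_span_singleton]
    refine Dvd.intro_left (ψ₂ u) ?_
    congr 1
    exact (ψ₂.commutes t).symm

end Points

end MvPowerSeries

/-! ### Translates compared with the constant subscheme modulo t ^ N. -/

namespace MvPowerSeries

variable {σ k A : Type*} [Field k] [CommRing A]

theorem exists_projection_map [Finite σ] (m : MonomialOrder σ) (I₀ : Ideal (MvPowerSeries σ k))
    (φ : k →+* A) :
    ∃ D : MvPowerSeries σ A →ₗ[A] MvPowerSeries σ A,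
      (∀ f, f - D f ∈ I₀.map (map φ)) ∧ (∀ f ∈ I₀.map (map φ), D f = 0) ∧
      (∀ r, (∀ α ∈ leadingExponents m I₀, coeff α r = 0) → D r = r) ∧
      ∀ f, ∀ α ∈ leadingExponents m I₀, coeff α (D f) = 0 := by
  let : Algebra k A := φ.toAlgebra
  exact exists_projection _ _ (exists_sub_mem_map m I₀)
    (fun r hr h0 => eq_zero_of_mem_map m I₀ hr h0)

/-- A functional with ℓ 1 ≠ 0, scaled by (ℓ 1)⁻¹, retracts A onto k, and `mapLinear` of it retracts
the extended ideal to I₀. -/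
theorem mem_of_map_mem_map [Nontrivial A] (φ : k →+* A) {I₀ : Ideal (MvPowerSeries σ k)}
    {f : MvPowerSeries σ k} (hf : f.map φ ∈ I₀.map (map φ)) : f ∈ I₀ := by
  let : Algebra k A := φ.toAlgebra
  obtain ⟨ℓ, hℓ⟩ : ∃ ℓ : Module.Dual k A, ℓ 1 ≠ 0 := by
    by_contra! h
    exact one_ne_zero ((Module.forall_dual_apply_eq_zero_iff k _).1 h)
  have h := mapLinear_mem ((ℓ 1)⁻¹ • ℓ) hf
  have : mapLinear ((ℓ 1)⁻¹ • ℓ) (f.map φ) = f := by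
    ext d
    have h1 : φ (coeff d f) = coeff d f • (1 : A) := by
      rw [Algebra.smul_def, mul_one]
      rfl
    rw [coeff_mapLinear, coeff_map, h1, map_smul, LinearMap.smul_apply, smul_eq_mul, smul_eq_mul,
      inv_mul_cancel₀ hℓ, mul_one]
  rwa [this] at h

end MvPowerSeries

namespace MvFormalGroup

open MvPowerSeries

variable {n : ℕ} {k : Type*} [Field k] (G : MvFormalGroup n k)

section

variable {A : Type*} [CommRing A] (𝔞 : Ideal A) [IsAdicComplete 𝔞 A] (φ : k →+* A)
  (g : AdicPoint n 𝔞)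

/-- The translation `f ↦ f(x + g)` as a linear map. -/
noncomputable def translationLinear : MvPowerSeries (Fin n) A →ₗ[A] MvPowerSeries (Fin n) A :=
  { G.translationHom 𝔞 φ g with
    map_smul' := fun c f => by
      change G.translationHom 𝔞 φ g (c • f) = c • G.translationHom 𝔞 φ g f
      rw [smul_eq_C_mul, smul_eq_C_mul, map_mul, translationHom_C] }

theorem translationLinear_apply (f : MvPowerSeries (Fin n) A) :
    G.translationLinear 𝔞 φ g f = G.translationHom 𝔞 φ g f := rfl

/-- This is the hypothesis on T in the contraction lemmas, with 𝔫 generated by the coordinates of g.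
-/
theorem translationLinear_sub_mem (f : MvPowerSeries (Fin n) A) :
    G.translationLinear 𝔞 φ g f - f ∈
      (Ideal.span (Set.range fun i => (g i : A)) • ⊤ : Submodule A (MvPowerSeries (Fin n) A)) := by
  refine mem_smul_top_of_coeff_mem (Submodule.fg_span (Set.finite_range _)) fun d => ?_
  have := G.map_translationHom_of_eq_zero 𝔞 φ g
    (Ideal.Quotient.mk (Ideal.span (Set.range fun i => (g i : A))))
    (fun i => Ideal.Quotient.eq_zero_iff_mem.2 (Ideal.subset_span ⟨i, rfl⟩)) f
  rw [map_sub, ← Ideal.Quotient.eq, translationLinear_apply]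
  simpa using congr_arg (coeff d) this

omit [IsAdicComplete 𝔞 A] in
theorem exists_span_pow_le :
    ∃ l, Ideal.span (Set.range fun i => (g i : A)) ^ l ≤ 𝔞 := by
  refine Ideal.exists_pow_le_of_le_radical_of_fg ?_ (Submodule.fg_span (Set.finite_range _))
  rw [Ideal.span_le]
  rintro _ ⟨i, rfl⟩
  exact (g i).2

theorem bijective_translationLinear {u : A} (hu : 𝔞 = Ideal.span {u}) :
    Function.Bijective (G.translationLinear 𝔞 φ g) := by
  subst hu
  obtain ⟨l, hl⟩ := exists_span_pow_le _ g
  exact bijective_of_isNearIdentity hl (G.translationLinear_sub_mem _ φ g)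

/-- Evaluation of power series at a point. -/
theorem exists_eval {R : Type*} [CommRing R] [Algebra R A] :
    ∃ ev : MvPowerSeries (Fin n) R →+* A, (∀ r, ev (C r) = algebraMap R A r) ∧
      ∀ i, ev (X i) = g i := by
  obtain ⟨e, hC, hX, -⟩ := exists_ringHom_eq_adicEval 𝔞
    (fun i => (C (g i : A) : MvPowerSeries (Fin n) A)) (fun i => by simp)
  exact ⟨(constantCoeff.comp e).comp (map (algebraMap R A)), fun r => by simp [hC],
    fun i => by simp [hX]⟩

end

section

variable {R A : Type*} [CommRing R] [CommRing A] [Algebra R A] {t : R} {s : k →+* R}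
  (m : MonomialOrder (Fin n)) {I : Ideal (MvPowerSeries (Fin n) R)}
  {I₀ : Ideal (MvPowerSeries (Fin n) k)}
  {𝔞 : Ideal A} (h𝔞 : 𝔞 = Ideal.span {algebraMap R A t}) [IsAdicComplete 𝔞 A]
  (g : AdicPoint n 𝔞)

include h𝔞 in
/-- If the translate by `g` of the formal subscheme defined by `I` is contained modulo `t ^ N` in
the constant formal subscheme defined by `I₀`, then the standard monomials of `I₀` are independent
modulo `I` and `t ^ N`. -/
theorem coeff_mem_span_pow_of_mem_sup {N : ℕ}
    (hQ : (I.map (map (algebraMap R A))).comap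
        (G.translationHom 𝔞 ((algebraMap R A).comp s) g) ≤
      I₀.map (map ((algebraMap R A).comp s)) ⊔ Ideal.span {C (algebraMap R A t) ^ N})
    {r : MvPowerSeries (Fin n) A} (hr : ∀ α ∈ leadingExponents m I₀, coeff α r = 0)
    (hrI : r ∈ I.map (map (algebraMap R A)) ⊔ Ideal.span {C (algebraMap R A t) ^ N})
    (d : Fin n →₀ ℕ) : coeff d r ∈ Ideal.span {algebraMap R A t} ^ N := by
  set φ := (algebraMap R A).comp s
  set u := algebraMap R A t
  obtain ⟨D, -, hD0, hD1, -⟩ := exists_projection_map m I₀ φ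
  let e := LinearEquiv.ofBijective _ (G.bijective_translationLinear 𝔞 φ g h𝔞)
  have he : ∀ f, e f = G.translationHom 𝔞 φ g f := fun _ => rfl
  set 𝔫 := Ideal.span (Set.range fun i => (g i : A))
  obtain ⟨l, hl⟩ := exists_span_pow_le 𝔞 g
  have hT : ∀ f, e.symm.toLinearMap f - f ∈ (𝔫 • ⊤ : Submodule A (MvPowerSeries (Fin n) A)) := by
    intro f
    have := neg_mem (G.translationLinear_sub_mem 𝔞 φ g (e.symm f))
    rw [translationLinear_apply, ← he, e.apply_symm_apply, neg_sub] at this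
    exact this
  have hsmul : ∀ v : MvPowerSeries (Fin n) A, C u ^ N * v = u ^ N • v := fun v => by
    rw [smul_eq_C_mul, map_pow]
  obtain ⟨i, hi, b, hb, rfl⟩ := Submodule.mem_sup.1 hrI
  obtain ⟨b, rfl⟩ := Ideal.mem_span_singleton.1 hb
  have h1 : e.symm i ∈ (I.map (map (algebraMap R A))).comap (G.translationHom 𝔞 φ g) := by
    rw [Ideal.mem_comap, ← he, e.apply_symm_apply]
    exact hi
  obtain ⟨a, ha, c, hc, hac⟩ := Submodule.mem_sup.1 (hQ h1)
  obtain ⟨c, rfl⟩ := Ideal.mem_span_singleton.1 hc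
  -- Translating back carries the I-part of r into I₀ up to t ^ N, and D kills I₀. As D fixes r,
  -- contraction for the inverse translation puts r in 𝔫 ^ (l * N) and t ^ N, and 𝔫 ^ l is already
  -- divisible by t.
  have h2 : D (e.symm.toLinearMap (i + C u ^ N * b)) = u ^ N • D (c + e.symm b) := by
    rw [LinearEquiv.coe_coe, map_add, ← hac, hsmul, hsmul, map_smul, map_add, map_add, hD0 a ha,
      zero_add, ← map_add, ← smul_add, map_smul]
  have h3 := mem_of_isNearIdentity hT (hD1 _ hr) (𝔠 := Ideal.span {u ^ N})
    (by
      rw [h2]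
      exact Submodule.smul_mem_smul (Ideal.mem_span_singleton_self _) trivial) (l * N)
  have h4 : 𝔫 ^ (l * N) ≤ Ideal.span {u} ^ N := by
    rw [pow_mul, ← h𝔞]
    exact Ideal.pow_right_mono hl N
  rw [← Ideal.span_singleton_pow] at h3
  have h5 : (𝔫 ^ (l * N) • ⊤ ⊔ Ideal.span {u} ^ N • ⊤ : Submodule A (MvPowerSeries (Fin n) A)) ≤
      Ideal.span {u} ^ N • ⊤ := sup_le (Submodule.smul_mono_left h4) le_rfl
  exact coeff_mem_of_mem_smul_top (h5 h3) d

variable {res : R →+* k} (hs : ∀ a, res (s a) = a) (hker : RingHom.ker res = Ideal.span {t})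
  (hproper : Ideal.span {algebraMap R A t} ≠ ⊤)

include h𝔞 hs hker hproper in
/-- If the translate by `g` of the formal subscheme defined by `I` is defined over a subring of `R`
which modulo `t ^ N` consists of constants, then this translate coincides modulo `t ^ N` with the
constant formal subscheme defined by the reduction of `I`. -/
theorem comap_le_and_le_of_formallyDefinedOver {N : ℕ} (R₀ : Subring R)
    (hR₀ : ∀ r ∈ R₀, t ^ N ∣ s (res r) - r)
    (hdef : FormallyDefinedOver ((algebraMap R A).comp R₀.subtype)
      ((I.map (map (algebraMap R A))).comap
        (G.translationHom 𝔞 ((algebraMap R A).comp s) g))) :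
    (I.map (map (algebraMap R A))).comap (G.translationHom 𝔞 ((algebraMap R A).comp s) g) ≤
        (I.map (map res)).map (map ((algebraMap R A).comp s)) ⊔
          Ideal.span {C (algebraMap R A t) ^ N} ∧
      (I.map (map res)).map (map ((algebraMap R A).comp s)) ≤
        (I.map (map (algebraMap R A))).comap (G.translationHom 𝔞 ((algebraMap R A).comp s) g) ⊔
          Ideal.span {C (algebraMap R A t) ^ N} := by
  set φ := (algebraMap R A).comp s with hφ
  set u := algebraMap R A t with hu
  set τ := G.translationHom 𝔞 φ g with hτ
  set Q := (I.map (map (algebraMap R A))).comap τ with hQ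
  obtain ⟨J, hJ⟩ := hdef
  rw [formalBaseChange] at hJ
  set J₀ := J.map (map (res.comp R₀.subtype)) with hJ₀
  -- reduction to the special fibre
  have hrad : 𝔞.radical ≠ ⊤ := by
    rw [Ne, Ideal.radical_eq_top, h𝔞]
    exact hproper
  have : Nontrivial (A ⧸ 𝔞.radical) := Ideal.Quotient.nontrivial_iff.2 hrad
  -- Modulo the radical both t and all coordinates of g vanish: R acts through its residue field and
  -- translation becomes the identity.
  let π := Ideal.Quotient.mk 𝔞.radical
  have hπu : π u = 0 := Ideal.Quotient.eq_zero_iff_mem.2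
    (Ideal.le_radical (h𝔞 ▸ Ideal.mem_span_singleton_self _))
  have hπres : ∀ r, π (algebraMap R A r) = π (φ (res r)) := by
    intro r
    have : s (res r) - r ∈ RingHom.ker res := by
      rw [RingHom.mem_ker, map_sub, hs, sub_self]
    rw [hker] at this
    obtain ⟨y, hy⟩ := Ideal.mem_span_singleton.1 this
    have h1 := congr_arg (fun z => π (algebraMap R A z)) hy
    simp only [map_sub, map_mul] at h1
    rw [← hu, hπu, MulZeroClass.zero_mul, sub_eq_zero] at h1
    exact h1.symm
  have hπτ : ∀ f, (τ f).map π = f.map π := fun f =>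
    G.map_translationHom_of_eq_zero 𝔞 φ g π (fun i => Ideal.Quotient.eq_zero_iff_mem.2 (g i).2) f
  have hπI : (I.map (map (algebraMap R A))).map (map π) =
      (I.map (map res)).map (map (π.comp φ)) := by
    rw [Ideal.map_map, Ideal.map_map]
    congr 1
    ext f d
    simp [hπres]
  have hπJ : (J.map (map ((algebraMap R A).comp R₀.subtype))).map (map π) =
      J₀.map (map (π.comp φ)) := by
    rw [hJ₀, Ideal.map_map, Ideal.map_map]
    congr 1
    ext f d
    simp [hπres]
  have hJI : J₀ ≤ I.map (map res) := by
    rw [hJ₀, Ideal.map_le_iff_le_comap]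
    intro f hf
    rw [Ideal.mem_comap]
    apply mem_of_map_mem_map (π.comp φ)
    have h1 : f.map ((algebraMap R A).comp R₀.subtype) ∈ Q := hJ ▸ Ideal.mem_map_of_mem _ hf
    have h2 := Ideal.mem_map_of_mem (map π) (Ideal.mem_comap.1 h1)
    rw [hπτ, hπI] at h2
    convert h2 using 1
    ext d
    simp [hπres]
  have hIJ : I.map (map res) ≤ J₀ := by
    rw [Ideal.map_le_iff_le_comap]
    intro f hf
    rw [Ideal.mem_comap]
    apply mem_of_map_mem_map (π.comp φ)
    -- Surjectivity of translation writes an element of I as the translate of some h in Q, which can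
    -- then be compared with J.
    obtain ⟨h, hh⟩ := (G.bijective_translationLinear 𝔞 φ g h𝔞).2 (f.map (algebraMap R A))
    rw [translationLinear_apply] at hh
    have h1 : h ∈ Q := by
      rw [hQ, Ideal.mem_comap, hτ, hh]
      exact Ideal.mem_map_of_mem _ hf
    rw [← hJ] at h1
    have h2 := Ideal.mem_map_of_mem (map π) h1
    rw [hπJ, ← hπτ, hτ, hh] at h2
    convert h2 using 1
    ext d
    simp [hπres]
  -- comparison modulo `t ^ N`
  have hcmp : ∀ f : MvPowerSeries (Fin n) R₀, ∃ b : MvPowerSeries (Fin n) A,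
      (f.map (res.comp R₀.subtype)).map φ =
        f.map ((algebraMap R A).comp R₀.subtype) + C u ^ N * b := by
    intro f
    obtain ⟨b, hb⟩ := exists_eq_C_mul_of_dvd (t := t ^ N)
      (f := (f.map (res.comp R₀.subtype)).map s - f.map R₀.subtype) (fun d => by
        simpa using hR₀ _ (coeff d f).2)
    refine ⟨b.map (algebraMap R A), ?_⟩
    have h1 := congr_arg (map (algebraMap R A)) hb
    rw [map_sub, map_mul, map_C, map_pow, map_pow, sub_eq_iff_eq_add', ← hu] at h1
    convert h1 using 1
    all_goals
      ext d
      simp [hφ]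
  have hspan : ∀ b : MvPowerSeries (Fin n) A, C u ^ N * b ∈ Ideal.span {C u ^ N} := fun b =>
    Ideal.mul_mem_right _ _ (Ideal.mem_span_singleton_self _)
  constructor
  · rw [← hJ, Ideal.map_le_iff_le_comap]
    intro f hf
    obtain ⟨b, hb⟩ := hcmp f
    rw [Ideal.mem_comap, ← sub_eq_iff_eq_add.2 hb]
    refine sub_mem (Ideal.mem_sup_left (Ideal.mem_map_of_mem _ (hJI ?_)))
      (Ideal.mem_sup_right (hspan b))
    exact Ideal.mem_map_of_mem _ hf
  · refine (Ideal.map_mono hIJ).trans ?_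
    rw [hJ₀, Ideal.map_map, Ideal.map_le_iff_le_comap]
    intro f hf
    obtain ⟨b, hb⟩ := hcmp f
    rw [Ideal.mem_comap, RingHom.comp_apply, hb]
    refine add_mem (Ideal.mem_sup_left ?_) (Ideal.mem_sup_right (hspan b))
    rw [← hJ]
    exact Ideal.mem_map_of_mem _ hf

end

end MvFormalGroup

/-! ### From approximate to exact translates. -/

namespace MvFormalGroup

open MvPowerSeries

section

variable {n : ℕ} {k : Type*} [Field k] (G : MvFormalGroup n k)
  {R : Type*} [CommRing R] {t : R} {s : k →+* R} {res : R →+* k} (hs : ∀ a, res (s a) = a)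
  (hker : RingHom.ker res = Ideal.span {t}) (m : MonomialOrder (Fin n))
  (I : Ideal (MvPowerSeries (Fin n) R))

include hs hker in
/-- The condition `f(x + y) ∈ I` on `y`, for a function `f` in the reduction of `I`, expressed by
the coefficients of a remainder. -/
theorem exists_remainder [IsNoetherianRing R] [IsAdicComplete (Ideal.span {t}) R]
    {f : MvPowerSeries (Fin n) k} :
    ∃ r : MvPowerSeries (Fin n) (MvPowerSeries (Fin n) R),
      (∀ α ∈ leadingExponents m (I.map (map res)), coeff α r = 0) ∧
      ∀ {A : Type*} [CommRing A] [Algebra R A] (𝔞 : Ideal A) [IsAdicComplete 𝔞 A]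
        (g : AdicPoint n 𝔞) (ev : MvPowerSeries (Fin n) R →+* A),
        (∀ a, ev (C a) = algebraMap R A a) → (∀ i, ev (X i) = g i) →
        G.translationHom 𝔞 ((algebraMap R A).comp s) g (f.map ((algebraMap R A).comp s)) -
          r.map ev ∈ I.map (map (algebraMap R A)) := by
  let S := MvPowerSeries (Fin n) R
  let 𝔶 : Ideal S := Ideal.span (Set.range X)
  -- The universal point: S = R⟦y⟧ is taken (y)-adically to translate and t-adically to divide.
  -- Specializing y to g then handles every point at once.
  let y : AdicPoint n 𝔶 := fun i => ⟨X i, Ideal.le_radical (Ideal.subset_span ⟨i, rfl⟩)⟩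
  obtain ⟨r, hr, hfr⟩ := exists_sub_mem_map_of_isAdicComplete (S := S) hs hker m I
    (G.translationHom 𝔶 ((C : R →+* S).comp s) y (f.map ((C : R →+* S).comp s)))
  refine ⟨r, hr, fun {A} _ _ 𝔞 _ g ev hC hX => ?_⟩
  have hev : ev.comp (C : R →+* S) = algebraMap R A := RingHom.ext hC
  have h1 := Ideal.mem_map_of_mem (map ev) hfr
  rw [map_sub, G.map_translationHom 𝔶 _ y 𝔞 g ev hX, ← RingHom.comp_assoc, hev, Ideal.map_map] at h1
  have h2 : (map ev).comp (map (algebraMap R S)) = map (σ := Fin n) (algebraMap R A) := by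
    ext h d
    simp only [RingHom.comp_apply, coeff_map]
    exact hC _
  have h3 : (f.map ((C : R →+* S).comp s)).map ev = f.map ((algebraMap R A).comp s) := by
    ext d
    simpa using hC _
  rwa [h2, h3] at h1

end

section

variable {R K Ω : Type*} [CommRing R] [IsDomain R] [IsDiscreteValuationRing R] [Field K]
  [Algebra R K] [IsFractionRing R K] [Field Ω] [Algebra K Ω] [Algebra R Ω] [IsScalarTower R K Ω]
  [IsAlgClosed Ω] [Algebra.IsAlgebraic K Ω]

/-- A closed formal subscheme of a formal group over a complete discrete valuation ring `R` with
coefficient field `k` which, for every `N`, has a translate over a finite extension of `R` that is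
defined over a subring of `R` consisting modulo `t ^ N` of constants, has a translate over a finite
extension of `R` that is defined over `k`. -/
theorem exists_translate_formallyDefinedOver_coefficientField {n : ℕ} {k : Type*} [Field k]
    (G : MvFormalGroup n k) {t : R} (ht : Irreducible t) [IsAdicComplete (Ideal.span {t}) R]
    {s : k →+* R} {res : R →+* k} (hs : ∀ a, res (s a) = a)
    (hker : RingHom.ker res = Ideal.span {t}) (I : Ideal (MvPowerSeries (Fin n) R))
    (h : ∀ N : ℕ, ∃ (R₀ : Subring R) (_ : ∀ r ∈ R₀, t ^ N ∣ s (res r) - r)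
      (K' : IntermediateField K Ω) (_ : FiniteDimensional K K')
      (g : AdicPoint n ((IsLocalRing.maximalIdeal R).map
        (algebraMap R (integralClosure R K')))),
      FormallyDefinedOver ((algebraMap R (integralClosure R K')).comp R₀.subtype)
        (G.translate _ ((algebraMap R (integralClosure R K')).comp s) g
          (formalBaseChange (algebraMap R (integralClosure R K')) I))) :
    ∃ (K' : IntermediateField K Ω) (_ : FiniteDimensional K K')
      (g : AdicPoint n ((IsLocalRing.maximalIdeal R).map
        (algebraMap R (integralClosure R K')))),
      FormallyDefinedOver ((algebraMap R (integralClosure R K')).comp s)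
        (G.translate _ ((algebraMap R (integralClosure R K')).comp s) g
          (formalBaseChange (algebraMap R (integralClosure R K')) I)) := by
  classical
  let m : MonomialOrder (Fin n) := MonomialOrder.lex
  let I₀ := I.map (map res)
  let U := leadingExponents m I₀
  have hmax : ∀ K' : IntermediateField K Ω, (IsLocalRing.maximalIdeal R).map
      (algebraMap R (integralClosure R K')) =
        Ideal.span {algebraMap R (integralClosure R K') t} := fun K' => by
    rw [ht.maximalIdeal_eq, Ideal.map_span, Set.image_singleton]
  have hcomplete : ∀ (K' : IntermediateField K Ω) [FiniteDimensional K K'],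
      IsAdicComplete ((IsLocalRing.maximalIdeal R).map (algebraMap R (integralClosure R K')))
        (integralClosure R K') := fun K' _ => by
    rw [IsAdicComplete.map_algebraMap_iff, ht.maximalIdeal_eq]
    exact isAdicComplete_integralClosure (K := K) ht
  have hdvd : ∀ (K' : IntermediateField K Ω) (a b : R), algebraMap R (integralClosure R K') a ∣
      algebraMap R (integralClosure R K') b → a ∣ b := fun K' a b hab =>
    dvd_of_algebraMap_dvd_integralClosure (K := K) hab
  have hproper : ∀ K' : IntermediateField K Ω,
      Ideal.span {algebraMap R (integralClosure R K') t} ≠ ⊤ := fun K' htop => by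
    rw [Ideal.span_singleton_eq_top, isUnit_iff_dvd_one, ← map_one (algebraMap R _)] at htop
    exact ht.not_isUnit (isUnit_iff_dvd_one.2 (hdvd K' _ _ htop))
  have hdata : ∀ N : ℕ, ∃ (K' : IntermediateField K Ω) (_ : FiniteDimensional K K')
      (g : AdicPoint n ((IsLocalRing.maximalIdeal R).map (algebraMap R (integralClosure R K')))),
      have := hcomplete K'
      (I.map (map (algebraMap R (integralClosure R K')))).comap
          (G.translationHom _ ((algebraMap R (integralClosure R K')).comp s) g) ≤
        I₀.map (map ((algebraMap R (integralClosure R K')).comp s)) ⊔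
          Ideal.span {C (algebraMap R (integralClosure R K') t) ^ N} ∧
      I₀.map (map ((algebraMap R (integralClosure R K')).comp s)) ≤
        (I.map (map (algebraMap R (integralClosure R K')))).comap
          (G.translationHom _ ((algebraMap R (integralClosure R K')).comp s) g) ⊔
          Ideal.span {C (algebraMap R (integralClosure R K') t) ^ N} := fun N => by
    obtain ⟨R₀, hR₀, K', hK', g, hg⟩ := h N
    have := hcomplete K'
    rw [translate_eq_comap, formalBaseChange] at hg
    exact ⟨K', hK', g, G.comap_le_and_le_of_formallyDefinedOver (hmax K') g hs hker (hproper K')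
      R₀ hR₀ hg⟩
  -- independence of the standard monomials modulo `I` over `R`
  have huniqR : ∀ r ∈ I, (∀ α ∈ U, coeff α r = 0) → r = 0 := by
    intro r hrI hr
    ext d
    rw [coeff_zero, IsHausdorff.eq_iff_smodEq (I := Ideal.span {t})]
    intro N
    obtain ⟨K', hK', g, hg, -⟩ := hdata N
    have := hcomplete K'
    -- Since r is in I and standard, all its coefficients are divisible by t ^ N in the extension,
    -- hence in R.
    have h1 := G.coeff_mem_span_pow_of_mem_sup m (hmax K') g hg
      (r := r.map (algebraMap R (integralClosure R K')))
      (fun α hα => by rw [coeff_map, hr α hα, map_zero])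
      (Ideal.mem_sup_left (Ideal.mem_map_of_mem _ hrI)) d
    rw [Ideal.span_singleton_pow, Ideal.mem_span_singleton, ← map_pow, coeff_map] at h1
    rw [SModEq.zero, smul_eq_mul, Ideal.mul_top, Ideal.span_singleton_pow,
      Ideal.mem_span_singleton]
    exact hdvd K' _ _ h1
  have huniq : ∀ (K' : IntermediateField K Ω) [FiniteDimensional K K'],
      ∀ r ∈ I.map (map (algebraMap R (integralClosure R K'))),
      (∀ α ∈ U, coeff α r = 0) → r = 0 := by
    intro K' _ r hrI hr
    have := finite_integralClosure (K := K) (L := K') ht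
    have := isTorsionFree_integralClosure (R := R) (K := K) (L := K')
    ext1 d
    -- The integral closure is finite and torsion-free over R, so R-linear functionals separate its
    -- elements and uniqueness descends to R.
    rw [coeff_zero, ← Module.forall_dual_apply_eq_zero_iff R]
    intro φ
    rw [← coeff_mapLinear, huniqR _ (mapLinear_mem φ hrI) fun α hα => by
      rw [coeff_mapLinear, hr α hα, map_zero], coeff_zero]
  choose r hrU hr using fun f : MvPowerSeries (Fin n) k => G.exists_remainder hs hker m I (f := f)
  let 𝔟 : Ideal (MvPowerSeries (Fin n) R) := Ideal.span {c | ∃ f ∈ I₀, ∃ d, coeff d (r f) = c}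
  have h𝔟 : ∀ N : ℕ, C t ^ N ∉ 𝔟 := by
    intro M hM
    -- The approximate solution of order M + 1 kills 𝔟 modulo t ^ (M + 1), whereas t ^ M does not
    -- vanish there.
    obtain ⟨K', hK', g, hg, hg'⟩ := hdata (M + 1)
    have := hcomplete K'
    obtain ⟨ev, hevC, hevX⟩ := exists_eval _ g (R := R)
    have hle : 𝔟 ≤ (Ideal.span {algebraMap R (integralClosure R K') t} ^ (M + 1)).comap ev := by
      rw [Ideal.span_le]
      rintro _ ⟨f, hf, d, rfl⟩
      obtain ⟨a, ha, c, hc, hac⟩ := Submodule.mem_sup.1 (hg' (Ideal.mem_map_of_mem _ hf))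
      obtain ⟨c, rfl⟩ := Ideal.mem_span_singleton.1 hc
      have h1 := hr f _ g ev hevC hevX
      rw [← hac, map_add, map_mul, map_pow, translationHom_C] at h1
      have h2 : (r f).map ev ∈ I.map (map (algebraMap R (integralClosure R K'))) ⊔
          Ideal.span {C (algebraMap R (integralClosure R K') t) ^ (M + 1)} := by
        refine (Submodule.sub_mem_iff_right _ ?_).1 (Ideal.mem_sup_left h1)
        exact add_mem (Ideal.mem_sup_left ha)
          (Ideal.mem_sup_right (Ideal.mul_mem_right _ _ (Ideal.mem_span_singleton_self _)))
      have h3 := G.coeff_mem_span_pow_of_mem_sup m (hmax K') g hg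
        (fun α hα => by rw [coeff_map, hrU f α hα, map_zero]) h2 d
      rwa [coeff_map] at h3
    have h1 := hle hM
    rw [Ideal.mem_comap, map_pow, hevC, Ideal.span_singleton_pow, Ideal.mem_span_singleton,
      ← map_pow, ← map_pow] at h1
    have h2 := hdvd K' _ _ h1
    rw [pow_dvd_pow_iff ht.ne_zero ht.not_isUnit] at h2
    omega
  obtain ⟨K', hK', ψ, hψC, hψ𝔟, hψX⟩ := exists_point_of_pow_notMem (K := K) (Ω := Ω) ht 𝔟 h𝔟
  have := hcomplete K'
  let g : AdicPoint n ((IsLocalRing.maximalIdeal R).map (algebraMap R (integralClosure R K'))) :=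
    fun i => ⟨ψ (X i), by rw [hmax]; exact hψX i⟩
  refine ⟨K', hK', g, I₀, ?_⟩
  rw [translate_eq_comap, formalBaseChange, formalBaseChange]
  set φ := (algebraMap R (integralClosure R K')).comp s
  have hle : I₀.map (map φ) ≤
      (I.map (map (algebraMap R (integralClosure R K')))).comap (G.translationHom _ φ g) := by
    rw [Ideal.map_le_iff_le_comap]
    intro f hf
    have h0 : (r f).map ψ = 0 := by
      ext1 d
      rw [coeff_map, coeff_zero]
      exact hψ𝔟 _ (Ideal.subset_span ⟨f, hf, d, rfl⟩)
    have h1 := hr f _ g ψ hψC fun _ => rfl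
    rwa [h0, sub_zero] at h1
  refine le_antisymm hle fun f hf => ?_
  obtain ⟨D, hD, -, -, hDU⟩ := exists_projection_map m I₀ φ
  have := isAdicComplete_integralClosure (K := K) (L := K') ht
  obtain ⟨P, -, hP0, hP1, -⟩ := exists_projection U
    (I.map (map (algebraMap R (integralClosure R K'))))
    (exists_sub_mem_map_of_isAdicComplete (S := integralClosure R K') hs hker m I) (huniq K')
  have hc := sub_mem hf (hle (hD f))
  rw [sub_sub_cancel, Ideal.mem_comap] at hc
  obtain ⟨l, hl⟩ := exists_span_pow_le _ g
  have : IsAdicComplete (Ideal.span {algebraMap R (integralClosure R K') t})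
      (integralClosure R K') := hmax K' ▸ hcomplete K'
  -- D takes remainders modulo I₀ and P modulo I, on the same standard monomials. So P fixes D f,
  -- while it kills the translate of D f, which lies in the extension of I.
  have h0 : D f = 0 := eq_zero_of_isNearIdentity (hl.trans (hmax K').le)
    (G.translationLinear_sub_mem _ φ g)
    (hP1 _ (hDU f)) (hP0 _ hc)
  have := hD f
  rwa [h0, sub_zero] at this

end
end MvFormalGroup

/-! ### The case of a local field of characteristic p. -/

theorem proposition2p24 (p : ℕ) [Fact p.Prime]
    (K : Type*) [Field K] [ValuativeRel K] [TopologicalSpace K] [IsNonarchimedeanLocalField K]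
    [CharP K p]
    (Kbar : Type*) [Field Kbar] [Algebra K Kbar] [IsAlgClosure K Kbar]
    (n : ℕ) (G : MvFormalGroup n 𝓀[K]) (I : Ideal (MvPowerSeries (Fin n) 𝒪[K]))
    (h : ∀ i : ℕ, ∃ (K' : IntermediateField K Kbar) (_ : FiniteDimensional K K')
      (g : AdicPoint n (extIdeal K K')),
      FormallyDefinedOver
        ((algebraMap 𝒪[K] (ExtInteger K K')).comp (iterateFrobenius 𝒪[K] p i).range.subtype)
        (G.translate (extIdeal K K')
          ((algebraMap 𝒪[K] (ExtInteger K K')).comp (coefficientField K p)) g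
          (formalBaseChange (algebraMap 𝒪[K] (ExtInteger K K')) I))) :
    ∃ (K' : IntermediateField K Kbar) (_ : FiniteDimensional K K')
      (g : AdicPoint n (extIdeal K K')),
      FormallyDefinedOver
        ((algebraMap 𝒪[K] (ExtInteger K K')).comp (coefficientField K p))
        (G.translate (extIdeal K K')
          ((algebraMap 𝒪[K] (ExtInteger K K')).comp (coefficientField K p)) g
          (formalBaseChange (algebraMap 𝒪[K] (ExtInteger K K')) I)) := by
  have := IsAlgClosure.isAlgClosed K (K := Kbar)
  have := IsAlgClosure.isAlgebraic (R := K) (K := Kbar)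
  obtain ⟨t, ht⟩ := IsDiscreteValuationRing.exists_irreducible 𝒪[K]
  have : IsAdicComplete (Ideal.span {t}) 𝒪[K] := by
    let := IsTopologicalAddGroup.rightUniformSpace K
    have := isUniformAddGroup_of_addCommGroup (G := K)
    rw [← ht.maximalIdeal_eq]
    infer_instance
  have hker : RingHom.ker (IsLocalRing.residue 𝒪[K]) = Ideal.span {t} := by
    rw [IsLocalRing.ker_residue, ht.maximalIdeal_eq]
  have hs := residue_coefficientField K p
  refine G.exists_translate_formallyDefinedOver_coefficientField ht hs hker I fun N => ?_
  refine ⟨(iterateFrobenius 𝒪[K] p N).range, ?_, h N⟩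
  rintro _ ⟨x, rfl⟩
  have hx : t ∣ coefficientField K p (IsLocalRing.residue 𝒪[K] x) - x := by
    rw [← Ideal.mem_span_singleton, ← hker, RingHom.mem_ker, map_sub, hs, sub_self]
  -- In characteristic p the difference for x ^ (p ^ N) is the p ^ N-th power of the one for x,
  -- hence divisible by t ^ (p ^ N), and p ^ N ≥ N.
  rw [iterateFrobenius_def, map_pow, map_pow, ← sub_pow_char_pow]
  exact (pow_dvd_pow t (Nat.lt_pow_self (Fact.out : p.Prime).one_lt).le).trans
    (pow_dvd_pow_of_dvd hx _)
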